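/- Let $\mathbb{F}$ be a field of characteristic $p>3$, let $n\ge 3$, and let $\underline{t}=(t_1,\dots,t_n)$ be a tuple of positive integers. Put $Y_0=\{1,\dots,n\}$, $Y_1=\{n+1,\dots,2n\}$, $Y=Y_0\cup Y_1$; let $\mu(i)=0$ and $i'=i+n$ for $i\in Y_0$, and $\mu(i)=1$ and $i'=i-n$ for $i\in Y_1$. Let $\mathcal{O}(n,n)=\mathcal{O}(n)\otimes\Lambda(n)$ be the tensor product of the divided power algebra $\mathcal{O}(n)$ over $\mathbb{F}$, with basis $x^{(\alpha)}$, $\alpha\in\mathbb{N}_0^n$, and multiplication $x^{(\alpha)}x^{(\beta)}=\binom{\alpha+\beta}{\alpha}x^{(\alpha+\beta)}$, and the exterior algebra $\Lambda(n)$ in the variables $x_{n+1},\dots,x_{2n}$, with basis the products $x^u$ in increasing order of the variables with index in $u\subseteq Y_1$. It is graded by $\mathbb{Z}/2$, the monomial $x^{(\alpha)}x^u$ having parity $|u|$ mod $2$, and has the superderivations $\partial_i$, $i\in Y$, with $\partial_i(x^{(\alpha)}x^u)=x^{(\alpha-\varepsilon_i)}x^u$ for $i\in Y_0$ (read as $0$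 if $\alpha_i=0$) and $\partial_i(x^{(\alpha)}x^u)=x^{(\alpha)}\,\partial x^u/\partial x_i$ for $i\in Y_1$. Let $\mathcal{O}(n,n;\underline{t})$ be the span of the $x^{(\alpha)}x^u$ with $0\le\alpha_i\le p^{t_i}-1$ for all $i\in Y_0$. Let $\mathrm{T_H}$ be the linear map with $$\mathrm{T_H}(a)=\sum_{i\in Y}(-1)^{\mu(i)\mathrm{p}(a)}\,\partial_i(a)\,\partial_{i'}$$ for homogeneous $a$ of parity $\mathrm{p}(a)$, and let $HO(n,n;\underline{t})=\{\mathrm{T_H}(a)\mid a\in\mathcal{O}(n,n;\underline{t})\}$ be the odd Hamiltonian superalgebra, a Lie superalgebra of superderivations under the supercommutator. Let $\mathcal{HO}$ be its even part, a Lie algebra under the commutator. Then the outer derivation algebra $\mathrm{Der}(\mathcal{HO})/\mathrm{ad}(\mathcal{HO})$ of $\mathcal{HO}$ is an abelian Lie algebra of finite dimension $$\dim_{\mathbb{F}}\bigl(\mathrm{Der}(\mathcal{HO})/\mathrm{ad}(\mathcal{HO})\bigr)=\sum_{i\in Y_0}t_i-n+1 .$$ -/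

import Mathlib

namespace OddHamiltonian

noncomputable section

/-- The monomials `x^(α) x^u` of `𝒪(n,n)`: an exponent `α ∈ ℕ₀ⁿ` of the divided power variables
`x_1, …, x_n` and a set `u` of indices of the exterior variables `x_{n+1}, …, x_{2n}` (the element
`k : Fin n` of `u` stands for the variable `x_{n+k}`; the factors of `x^u` are in increasing
order). -/
abbrev Mon (n : ℕ) : Type := (Fin n → ℕ) × Finset (Fin n)

/-- The superspace `𝒪(n,n) = 𝒪(n) ⊗ Λ(n)` over `F`, with basis the monomials `x^(α) x^u`. -/
abbrev O (F : Type*) [Field F] (n : ℕ) : Type _ := Mon n →₀ F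

/-- The index set `Y = Y₀ ∪ Y₁`: `Sum.inl i` is the index of the even variable `x_i`, and
`Sum.inr i` is the index `n + i` of an odd variable. The involution `i ↦ i'` is `Sum.swap`. -/
abbrev Y (n : ℕ) : Type := Fin n ⊕ Fin n

/-- The parity `μ(i)` of an index, as `0` or `1`. -/
def mu {n : ℕ} : Y n → ℕ
  | Sum.inl _ => 0
  | Sum.inr _ => 1

/-- The multi-index binomial coefficient `(α + β choose α)`. -/
def mchoose {n : ℕ} (α β : Fin n → ℕ) : ℕ := ∏ i, (α i + β i).choose (α i)

/-- The number of inversions of the concatenation of `u` and `v`, so that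
`x^u x^v = (-1)^(inv u v) x^(u ∪ v)` for disjoint `u` and `v`. -/
def inv {n : ℕ} (u v : Finset (Fin n)) : ℕ := ((u ×ˢ v).filter fun q => q.2 < q.1).card

/-- The product of two monomials. -/
def monMul (F : Type*) [Field F] {n : ℕ} (a b : Mon n) : O F n :=
  if Disjoint a.2 b.2 then
    Finsupp.single (a.1 + b.1, a.2 ∪ b.2) ((mchoose a.1 b.1 : F) * (-1) ^ inv a.2 b.2)
  else 0

/-- The multiplication of `𝒪(n,n)`, as a bilinear map. -/
def mul (F : Type*) [Field F] (n : ℕ) : O F n →ₗ[F] O F n →ₗ[F] O F n :=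
  Finsupp.linearCombination F fun a => Finsupp.linearCombination F fun b => monMul F a b

/-- The value of `∂_r` on a monomial; `x^u` with `k ∈ u` is sent by `∂/∂x_{n+k}` to
`(-1)^s x^(u \ {k})`, where `s` is the number of elements of `u` below `k`. -/
def monPartial (F : Type*) [Field F] {n : ℕ} : Y n → Mon n → O F n
  | Sum.inl i, a => if a.1 i = 0 then 0 else Finsupp.single (a.1 - Pi.single i 1, a.2) 1
  | Sum.inr k, a =>
      if k ∈ a.2 then
        Finsupp.single (a.1, a.2.erase k) ((-1) ^ (a.2.filter fun j => j < k).card)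
      else 0

/-- The superderivation `∂_r` of `𝒪(n,n)`, for `r ∈ Y`. -/
def partialD (F : Type*) [Field F] (n : ℕ) (r : Y n) : O F n →ₗ[F] O F n :=
  Finsupp.linearCombination F (monPartial F r)

/-- The `ℤ/2`-grading of `𝒪(n,n)`: the span of the monomials `x^(α) x^u` with `|u| ≡ θ`. -/
def parityPart (F : Type*) [Field F] (n : ℕ) (θ : ZMod 2) : Submodule F (O F n) :=
  Finsupp.supported F F {a : Mon n | (a.2.card : ZMod 2) = θ}

/-- The finite-dimensional subalgebra `𝒪(n,n;t)`: the span of the monomials `x^(α) x^u` with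
`α_i ≤ p^(t_i) - 1` for all `i`. -/
def truncated (F : Type*) [Field F] (p : ℕ) {n : ℕ} (t : Fin n → ℕ) : Submodule F (O F n) :=
  Finsupp.supported F F {a : Mon n | ∀ i, a.1 i < p ^ t i}

/-- The operator `f ∂_r : g ↦ f · ∂_r(g)`. -/
def vf (F : Type*) [Field F] (n : ℕ) (f : O F n) (r : Y n) : Module.End F (O F n) :=
  mul F n f ∘ₗ partialD F n r

/-- The linear map `T_H`, given on homogeneous elements by
`T_H(a) = ∑_{i ∈ Y} (-1)^(μ(i) p(a)) ∂_i(a) ∂_{i'}`; its values are in `W(n,n)`, realized as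
operators on `𝒪(n,n)`. -/
def TH (F : Type*) [Field F] (n : ℕ) : O F n →ₗ[F] Module.End F (O F n) :=
  Finsupp.linearCombination F fun a : Mon n =>
    ∑ i : Y n, (-1 : F) ^ (mu i * a.2.card) •
      vf F n (partialD F n i (Finsupp.single a 1)) i.swap

/-- The odd Hamiltonian superalgebra `HO(n,n;t) = {T_H(a) | a ∈ 𝒪(n,n;t)}`. -/
def HO (F : Type*) [Field F] (p : ℕ) {n : ℕ} (t : Fin n → ℕ) :
    Submodule F (Module.End F (O F n)) :=
  (truncated F p t).map (TH F n)

/-- The even operators on `𝒪(n,n)`: those that preserve parity. -/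
def evenEnd (F : Type*) [Field F] (n : ℕ) : Submodule F (Module.End F (O F n)) where
  carrier := {D | ∀ θ, ∀ f ∈ parityPart F n θ, D f ∈ parityPart F n θ}
  zero_mem' := fun θ _ _ => (parityPart F n θ).zero_mem
  add_mem' := fun hD hE θ f hf => (parityPart F n θ).add_mem (hD θ f hf) (hE θ f hf)
  smul_mem' := fun c _ hD θ f hf => (parityPart F n θ).smul_mem c (hD θ f hf)

variable {F : Type*} [Field F] {n : ℕ}

theorem mul_single (a b : Mon n) (x y : F) :
    mul F n (Finsupp.single a x) (Finsupp.single b y) = (x * y) • monMul F a b := by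
  simp [mul, Finsupp.linearCombination_single, smul_smul]

theorem partialD_single (r : Y n) (a : Mon n) (x : F) :
    partialD F n r (Finsupp.single a x) = x • monPartial F r a := by
  simp [partialD, Finsupp.linearCombination_single]

theorem choose_cocycle (a b c : ℕ) :
    (a + b).choose a * (a + b + c).choose (a + b) =
      (b + c).choose b * (a + (b + c)).choose a := by
  have h := Nat.choose_mul (n := a + b + c) (k := a + b) (s := a) (by omega)
  have e1 : a + b + c - a = b + c := by omega
  have e2 : a + b - a = b := by omega
  rw [e1, e2] at h
  rw [mul_comm, h, mul_comm, add_assoc]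

theorem mchoose_cocycle (α β γ : Fin n → ℕ) :
    mchoose α β * mchoose (α + β) γ = mchoose β γ * mchoose α (β + γ) := by
  simp only [mchoose, ← Finset.prod_mul_distrib, Pi.add_apply]
  exact Finset.prod_congr rfl fun i _ => choose_cocycle _ _ _

theorem mchoose_comm (α β : Fin n → ℕ) : mchoose α β = mchoose β α := by
  refine Finset.prod_congr rfl fun i _ => ?_
  rw [add_comm (β i), ← Nat.choose_symm_add]

theorem inv_union_left {u v w : Finset (Fin n)} (h : Disjoint u v) :
    inv (u ∪ v) w = inv u w + inv v w := by
  unfold inv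
  rw [Finset.union_product, Finset.filter_union, Finset.card_union_of_disjoint]
  refine Finset.disjoint_filter_filter ?_
  rw [Finset.disjoint_product]
  exact Or.inl h

theorem inv_union_right {u v w : Finset (Fin n)} (h : Disjoint v w) :
    inv u (v ∪ w) = inv u v + inv u w := by
  unfold inv
  rw [Finset.product_union, Finset.filter_union, Finset.card_union_of_disjoint]
  refine Finset.disjoint_filter_filter ?_
  rw [Finset.disjoint_product]
  exact Or.inr h

theorem inv_singleton_left (k : Fin n) (v : Finset (Fin n)) :
    inv {k} v = (v.filter fun j => j < k).card := by
  unfold inv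
  rw [Finset.singleton_product, Finset.filter_map, Finset.card_map]
  rfl

theorem inv_singleton_right (k : Fin n) (u : Finset (Fin n)) :
    inv u {k} = (u.filter fun j => k < j).card := by
  unfold inv
  rw [Finset.product_singleton, Finset.filter_map, Finset.card_map]
  rfl

theorem inv_add_inv {u v : Finset (Fin n)} (h : Disjoint u v) :
    inv u v + inv v u = u.card * v.card := by
  have e : inv v u = ((u ×ˢ v).filter fun q => ¬ q.2 < q.1).card := by
    unfold inv
    rw [← Finset.map_swap_product, Finset.filter_map, Finset.card_map]
    congr 1
    refine Finset.filter_congr fun q hq => ?_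
    have hne : q.1 ≠ q.2 := fun he =>
      Finset.disjoint_left.1 h (Finset.mem_product.1 hq).1 (he ▸ (Finset.mem_product.1 hq).2)
    simp only [Function.comp, Function.Embedding.coeFn_mk, Prod.fst_swap, Prod.snd_swap,
      not_lt]
    exact ⟨le_of_lt, fun hl => lt_of_le_of_ne hl hne⟩
  rw [e]
  unfold inv
  rw [Finset.card_filter_add_card_filter_not, Finset.card_product]

/-- The multiplication is associative. -/
theorem mul_assoc' (f g h : O F n) :
    mul F n (mul F n f g) h = mul F n f (mul F n g h) := by
  induction f using Finsupp.induction_linear with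
  | zero => simp
  | add f₁ f₂ h₁ h₂ => simp [h₁, h₂]
  | single a x =>
  induction g using Finsupp.induction_linear with
  | zero => simp
  | add f₁ f₂ h₁ h₂ => simp [h₁, h₂]
  | single b y =>
  induction h using Finsupp.induction_linear with
  | zero => simp
  | add f₁ f₂ h₁ h₂ => simp [h₁, h₂]
  | single c z =>
  obtain ⟨α, u⟩ := a
  obtain ⟨β, v⟩ := b
  obtain ⟨γ, w⟩ := c
  simp only [mul_single, monMul]
  by_cases huv : Disjoint u v
  · by_cases hvw : Disjoint v w
    · by_cases huw : Disjoint u w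
      · have h1 : Disjoint (u ∪ v) w := Finset.disjoint_union_left.2 ⟨huw, hvw⟩
        have h2 : Disjoint u (v ∪ w) := Finset.disjoint_union_right.2 ⟨huv, huw⟩
        simp only [huv, hvw, if_true, Finsupp.smul_single, smul_eq_mul, mul_single, monMul, h1, h2,
          add_assoc, Finset.union_assoc]
        congr 1
        rw [inv_union_left huv, inv_union_right hvw, pow_add, pow_add]
        have := congrArg (Nat.cast : ℕ → F) (mchoose_cocycle α β γ)
        push_cast at this
        linear_combination (x * y * z * (-1) ^ inv u v * (-1) ^ inv u w * (-1) ^ inv v w) * this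
      · have h1 : ¬ Disjoint (u ∪ v) w := fun h => huw (Finset.disjoint_union_left.1 h).1
        have h2 : ¬ Disjoint u (v ∪ w) := fun h => huw (Finset.disjoint_union_right.1 h).2
        simp only [huv, hvw, if_true, Finsupp.smul_single, smul_eq_mul, mul_single, monMul, h1, h2,
          if_false, smul_zero]
    · have h1 : ¬ Disjoint (u ∪ v) w := fun h => hvw (Finset.disjoint_union_left.1 h).2
      simp only [huv, hvw, if_true, Finsupp.smul_single, smul_eq_mul, mul_single, monMul, h1,
          if_false, smul_zero, map_zero]
  · by_cases hvw : Disjoint v w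
    · have h2 : ¬ Disjoint u (v ∪ w) := fun h => huv (Finset.disjoint_union_right.1 h).1
      simp only [huv, hvw, if_true, Finsupp.smul_single, smul_eq_mul, mul_single, monMul, h2,
          if_false, smul_zero, map_zero, LinearMap.zero_apply]
    · simp [huv, hvw]

theorem neg_one_pow_eq {j k : ℕ} (h : (j : ZMod 2) = k) : (-1 : F) ^ j = (-1) ^ k := by
  rw [ZMod.natCast_eq_natCast_iff] at h
  rw [neg_one_pow_eq_pow_mod_two, h, ← neg_one_pow_eq_pow_mod_two]

theorem parity_induction {θ : ZMod 2} {P : O F n → Prop} (h0 : P 0)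
    (hadd : ∀ f g, P f → P g → P (f + g))
    (hs : ∀ (a : Mon n) (x : F), (a.2.card : ZMod 2) = θ → P (Finsupp.single a x))
    {f : O F n} (hf : f ∈ parityPart F n θ) : P f := by
  have hf' : ∀ a ∈ f.support, (a.2.card : ZMod 2) = θ := fun a ha => hf ha
  rw [← Finsupp.sum_single f, Finsupp.sum]
  exact Finset.sum_induction _ P hadd h0 fun a ha => hs a _ (hf' a ha)

/-- The multiplication is super-commutative. -/
theorem mul_supercomm {j k : ℕ} {f g : O F n} (hf : f ∈ parityPart F n j)
    (hg : g ∈ parityPart F n k) : mul F n f g = (-1 : F) ^ (j * k) • mul F n g f := by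
  refine parity_induction (P := fun f => mul F n f g = (-1 : F) ^ (j * k) • mul F n g f)
    (by simp) (fun f₁ f₂ h₁ h₂ => by simp [h₁, h₂]) (fun a x ha => ?_) hf
  refine parity_induction (P := fun g => mul F n (Finsupp.single a x) g =
      (-1 : F) ^ (j * k) • mul F n g (Finsupp.single a x))
    (by simp) (fun f₁ f₂ h₁ h₂ => by simp [h₁, h₂]) (fun b y hb => ?_) hg
  simp only [mul_single, monMul]
  by_cases h : Disjoint a.2 b.2
  · simp only [h, h.symm, if_true, Finsupp.smul_single, smul_eq_mul, add_comm b.1,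
      Finset.union_comm b.2, mchoose_comm b.1]
    congr 1
    have e : (-1 : F) ^ (j * k) = (-1) ^ inv a.2 b.2 * (-1) ^ inv b.2 a.2 := by
      rw [← pow_add, inv_add_inv h]
      exact neg_one_pow_eq (by push_cast; rw [ha, hb])
    have e2 : (-1 : F) ^ inv b.2 a.2 * (-1) ^ inv b.2 a.2 = 1 := by
      rw [← mul_pow]; simp
    rw [e]
    linear_combination (-(x * y * (mchoose a.1 b.1 : F) * (-1) ^ inv a.2 b.2)) * e2
  · have h' : ¬ Disjoint b.2 a.2 := fun h' => h h'.symm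
    simp [h, h']

theorem single_mem_parityPart {θ : ZMod 2} {a : Mon n} (x : F) (h : (a.2.card : ZMod 2) = θ) :
    Finsupp.single a x ∈ parityPart F n θ :=
  Finsupp.single_mem_supported F x h

theorem mul_mem_parityPart {θ η : ZMod 2} {f g : O F n} (hf : f ∈ parityPart F n θ)
    (hg : g ∈ parityPart F n η) : mul F n f g ∈ parityPart F n (θ + η) := by
  refine parity_induction (P := fun f => mul F n f g ∈ parityPart F n (θ + η))
    (by simp) (fun f₁ f₂ h₁ h₂ => by simpa using add_mem h₁ h₂) (fun a x ha => ?_) hf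
  refine parity_induction (P := fun g => mul F n (Finsupp.single a x) g ∈ parityPart F n (θ + η))
    (by simp) (fun f₁ f₂ h₁ h₂ => by simpa using add_mem h₁ h₂) (fun b y hb => ?_) hg
  rw [mul_single, monMul]
  split_ifs with h
  · refine Submodule.smul_mem _ _ (single_mem_parityPart _ ?_)
    rw [Finset.card_union_of_disjoint h]
    push_cast
    rw [ha, hb]
  · simp

theorem partialD_mem_parityPart {θ : ZMod 2} {f : O F n} (r : Y n)
    (hf : f ∈ parityPart F n θ) : partialD F n r f ∈ parityPart F n (θ + mu r) := by
  refine parity_induction (P := fun f => partialD F n r f ∈ parityPart F n (θ + mu r))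
    (by simp) (fun f₁ f₂ h₁ h₂ => by simpa using add_mem h₁ h₂) (fun a x ha => ?_) hf
  rw [partialD_single]
  refine Submodule.smul_mem _ _ ?_
  cases r with
  | inl i =>
    simp only [monPartial, mu]
    split_ifs
    · simp
    · exact single_mem_parityPart _ (by simpa using ha)
  | inr k =>
    simp only [monPartial, mu]
    split_ifs with h
    · refine single_mem_parityPart _ ?_
      have h2 : a.2.card = (a.2.erase k).card + 1 := (Finset.card_erase_add_one h).symm
      rw [h2] at ha
      rw [← ha]
      have : (2 : ZMod 2) = 0 := rfl
      push_cast
      linear_combination (-1 : ZMod 2) * this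
    · simp

theorem choose_split (a b : ℕ) (h : a + b ≠ 0) :
    (a + b).choose a = (if a = 0 then 0 else (a - 1 + b).choose (a - 1)) +
      (if b = 0 then 0 else (a + (b - 1)).choose a) := by
  rcases a with _ | a
  · rcases b with _ | b
    · omega
    · simp
  · rcases b with _ | b
    · simp
    · simp only [Nat.add_eq_zero_iff, one_ne_zero, and_false, if_false, Nat.add_sub_cancel]
      rw [show a + 1 + (b + 1) = (a + b + 1) + 1 by omega, Nat.choose_succ_succ]
      have e : a + (b + 1) = a + b + 1 := by omega
      have e' : a + 1 + b = a + b + 1 := by omega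
      rw [e, e']

theorem mchoose_split (α β : Fin n → ℕ) (i : Fin n) (h : α i + β i ≠ 0) :
    mchoose α β = (if α i = 0 then 0 else mchoose (α - Pi.single i 1) β) +
      (if β i = 0 then 0 else mchoose α (β - Pi.single i 1)) := by
  have key : ∀ α β : Fin n → ℕ, mchoose α β =
      (α i + β i).choose (α i) * ∏ j ∈ Finset.univ.erase i, (α j + β j).choose (α j) :=
    fun α β => (Finset.mul_prod_erase Finset.univ (fun j => (α j + β j).choose (α j))
      (Finset.mem_univ i)).symm
  have e1 : ∏ j ∈ Finset.univ.erase i,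
      ((α - Pi.single i 1 : Fin n → ℕ) j + β j).choose ((α - Pi.single i 1 : Fin n → ℕ) j) =
      ∏ j ∈ Finset.univ.erase i, (α j + β j).choose (α j) :=
    Finset.prod_congr rfl fun j hj => by simp [Finset.ne_of_mem_erase hj]
  have e2 : ∏ j ∈ Finset.univ.erase i,
      (α j + (β - Pi.single i 1 : Fin n → ℕ) j).choose (α j) =
      ∏ j ∈ Finset.univ.erase i, (α j + β j).choose (α j) :=
    Finset.prod_congr rfl fun j hj => by simp [Finset.ne_of_mem_erase hj]
  rw [key α β, key (α - Pi.single i 1) β, key α (β - Pi.single i 1), e1, e2,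
    choose_split _ _ h]
  simp only [Pi.sub_apply, Pi.single_eq_same]
  split_ifs <;> ring

theorem leibniz_inl (i : Fin n) (a b : Mon n) :
    partialD F n (Sum.inl i) (monMul F a b) =
      mul F n (monPartial F (Sum.inl i) a) (Finsupp.single b 1) +
        mul F n (Finsupp.single a 1) (monPartial F (Sum.inl i) b) := by
  obtain ⟨α, u⟩ := a
  obtain ⟨β, v⟩ := b
  have hα : α i ≠ 0 → α - Pi.single i 1 + β = α + β - Pi.single i 1 := by
    intro h
    ext j
    by_cases hj : j = i
    · subst hj; simp; omega
    · simp [hj]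
  have hβ : β i ≠ 0 → α + (β - Pi.single i 1) = α + β - Pi.single i 1 := by
    intro h
    ext j
    by_cases hj : j = i
    · subst hj; simp; omega
    · simp [hj]
  by_cases huv : Disjoint u v
  · by_cases h0 : α i + β i = 0
    · have h1 : α i = 0 := by omega
      have h2 : β i = 0 := by omega
      simp [-Finsupp.single_mul, monMul, monPartial, partialD_single, huv, h1, h2]
    · have hs := congrArg (Nat.cast : ℕ → F) (mchoose_split α β i h0)
      push_cast at hs
      by_cases h1 : α i = 0
      · have h2 : β i ≠ 0 := by omega
        simp [-Finsupp.single_mul, monMul, monPartial, partialD_single, mul_single, huv, h1, h2, hβ h2] at hs ⊢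
        rw [hs]
      · by_cases h2 : β i = 0
        · simp [-Finsupp.single_mul, monMul, monPartial, partialD_single, mul_single, huv, h1, h2, hα h1] at hs ⊢
          rw [hs]
        · simp [-Finsupp.single_mul, monMul, monPartial, partialD_single, mul_single, huv, h1, h2, hα h1, hβ h2]
            at hs ⊢
          rw [hs, ← Finsupp.single_add]
          congr 1
          ring
  · simp only [monMul, huv, if_false, map_zero, monPartial]
    split_ifs <;> simp [mul_single, monMul, huv]

theorem leibniz_inr (k : Fin n) (a b : Mon n) :
    partialD F n (Sum.inr k) (monMul F a b) =
      mul F n (monPartial F (Sum.inr k) a) (Finsupp.single b 1) +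
        (-1 : F) ^ a.2.card • mul F n (Finsupp.single a 1) (monPartial F (Sum.inr k) b) := by
  obtain ⟨α, u⟩ := a
  obtain ⟨β, v⟩ := b
  have sq : ∀ m : ℕ, (-1 : F) ^ m * (-1) ^ m = 1 := fun m => by rw [← mul_pow]; simp
  have hcard : ∀ w : Finset (Fin n), k ∈ w →
      w.card = (w.filter fun j => j < k).card + (w.filter fun j => k < j).card + 1 := by
    intro w hw
    have e1 := Finset.card_filter_add_card_filter_not (s := w) (fun j => j < k)
    have e2 : (w.filter fun j => ¬ j < k) = insert k (w.filter fun j => k < j) := by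
      ext j
      simp only [Finset.mem_filter, Finset.mem_insert, not_lt]
      constructor
      · rintro ⟨h1, h2⟩
        rcases h2.lt_or_eq with h | h
        · exact Or.inr ⟨h1, h⟩
        · exact Or.inl h.symm
      · rintro (h | ⟨h1, h2⟩)
        · subst h; exact ⟨hw, le_rfl⟩
        · exact ⟨h1, h2.le⟩
    rw [e2, Finset.card_insert_of_notMem (by simp)] at e1
    omega
  have fe1 : ∀ w : Finset (Fin n), ((w.erase k).filter fun j => j < k) =
      w.filter fun j => j < k := by
    intro w; ext j; simp only [Finset.mem_filter, Finset.mem_erase]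
    exact ⟨fun h => ⟨h.1.2, h.2⟩, fun h => ⟨⟨h.2.ne, h.1⟩, h.2⟩⟩
  have fe2 : ∀ w : Finset (Fin n), ((w.erase k).filter fun j => k < j) =
      w.filter fun j => k < j := by
    intro w; ext j; simp only [Finset.mem_filter, Finset.mem_erase]
    exact ⟨fun h => ⟨h.1.2, h.2⟩, fun h => ⟨⟨h.2.ne', h.1⟩, h.2⟩⟩
  have sl : ∀ w z : Finset (Fin n), k ∈ w →
      inv w z = inv (w.erase k) z + (z.filter fun j => j < k).card := by
    intro w z hw
    conv_lhs => rw [← Finset.insert_erase hw, Finset.insert_eq]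
    rw [inv_union_left (by simp), inv_singleton_left, add_comm]
  have sr : ∀ w z : Finset (Fin n), k ∈ z →
      inv w z = inv w (z.erase k) + (w.filter fun j => k < j).card := by
    intro w z hw
    conv_lhs => rw [← Finset.insert_erase hw, Finset.insert_eq]
    rw [inv_union_right (by simp), inv_singleton_right, add_comm]
  by_cases hu : k ∈ u
  · by_cases hv : k ∈ v
    · have huv : ¬ Disjoint u v := fun h => Finset.disjoint_left.1 h hu hv
      have heq : Disjoint (u.erase k) v ↔ Disjoint u (v.erase k) := by
        rw [Finset.disjoint_left, Finset.disjoint_left]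
        constructor
        · intro h x hx hxv
          exact h (Finset.mem_erase.2 ⟨(Finset.mem_erase.1 hxv).1, hx⟩) (Finset.mem_erase.1 hxv).2
        · intro h x hx hxv
          exact h (Finset.mem_erase.1 hx).2 (Finset.mem_erase.2 ⟨(Finset.mem_erase.1 hx).1, hxv⟩)
      by_cases hd : Disjoint (u.erase k) v
      · have hd' := heq.1 hd
        have hun : u ∪ v.erase k = u.erase k ∪ v := by
          ext x; by_cases hx : x = k
          · subst hx; simp [hu, hv]
          · simp [hx]
        simp only [monMul, monPartial, mul_single, huv, hu, hv, hd, hd', if_true, if_false,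
          map_zero, Finsupp.smul_single, hun]
        rw [← Finsupp.single_add, eq_comm, Finsupp.single_eq_zero]
        simp only [smul_eq_mul]
        rw [sr (u.erase k) v hv, sl u (v.erase k) hu, fe1, fe2, hcard u hu]
        simp only [pow_add, pow_one]
        have s1 := sq (v.filter fun j => j < k).card
        linear_combination (-((-1 : F) ^ (u.filter fun j => j < k).card *
          (-1) ^ (u.filter fun j => k < j).card * (mchoose α β : F) *
          (-1) ^ inv (u.erase k) (v.erase k))) * s1
      · have hd' : ¬ Disjoint u (v.erase k) := fun h => hd (heq.2 h)
        simp [-Finsupp.single_mul, monMul, monPartial, mul_single, huv, hu, hv, hd, hd']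
    · have heq : Disjoint (u.erase k) v ↔ Disjoint u v := by
        rw [Finset.disjoint_left, Finset.disjoint_left]
        refine ⟨fun h x hx hxv => ?_, fun h x hx => h (Finset.mem_erase.1 hx).2⟩
        exact h (Finset.mem_erase.2 ⟨fun e => hv (e ▸ hxv), hx⟩) hxv
      by_cases huv : Disjoint u v
      · have hd := heq.2 huv
        have hun : (u ∪ v).erase k = u.erase k ∪ v := by
          rw [Finset.erase_union_distrib, Finset.erase_eq_of_notMem hv]
        have hfil : ((u ∪ v).filter fun j => j < k).card =
            (u.filter fun j => j < k).card + (v.filter fun j => j < k).card := by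
          rw [Finset.filter_union, Finset.card_union_of_disjoint
            (Finset.disjoint_filter_filter huv)]
        simp only [monMul, monPartial, partialD_single, mul_single, huv, hu, hv, hd, if_true,
          if_false, map_zero, smul_zero, add_zero, Finsupp.smul_single, hun, Finset.mem_union,
          true_or, smul_eq_mul]
        congr 1
        rw [hfil, sl u v hu]
        simp only [pow_add]
        have s1 := sq (v.filter fun j => j < k).card
        linear_combination ((-1 : F) ^ (u.filter fun j => j < k).card * (mchoose α β : F) *
          (-1) ^ inv (u.erase k) v) * s1
      · have hd : ¬ Disjoint (u.erase k) v := fun h => huv (heq.1 h)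
        simp [-Finsupp.single_mul, monMul, monPartial, mul_single, huv, hu, hv, hd]
  · by_cases hv : k ∈ v
    · have heq : Disjoint u (v.erase k) ↔ Disjoint u v := by
        rw [Finset.disjoint_left, Finset.disjoint_left]
        refine ⟨fun h x hx hxv => ?_, fun h x hx hxv => h hx (Finset.mem_erase.1 hxv).2⟩
        exact h hx (Finset.mem_erase.2 ⟨fun e => hu (e ▸ hx), hxv⟩)
      by_cases huv : Disjoint u v
      · have hd := heq.2 huv
        have hun : (u ∪ v).erase k = u ∪ v.erase k := by
          rw [Finset.erase_union_distrib, Finset.erase_eq_of_notMem hu]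
        have hfil : ((u ∪ v).filter fun j => j < k).card =
            (u.filter fun j => j < k).card + (v.filter fun j => j < k).card := by
          rw [Finset.filter_union, Finset.card_union_of_disjoint
            (Finset.disjoint_filter_filter huv)]
        have hcu : u.card = (u.filter fun j => j < k).card + (u.filter fun j => k < j).card := by
          have h1 := hcard (insert k u) (Finset.mem_insert_self k u)
          rw [Finset.card_insert_of_notMem hu, ← fe1, ← fe2, Finset.erase_insert hu] at h1
          omega
        simp only [monMul, monPartial, partialD_single, mul_single, huv, hu, hv, hd, if_true,
          if_false, map_zero, zero_add, Finsupp.smul_single, hun, Finset.mem_union,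
          or_true, smul_eq_mul, LinearMap.zero_apply]
        congr 1
        rw [hfil, sr u v hv, hcu]
        simp only [pow_add]
        ring
      · have hd : ¬ Disjoint u (v.erase k) := fun h => huv (heq.1 h)
        simp [-Finsupp.single_mul, monMul, monPartial, mul_single, huv, hu, hv, hd]
    · by_cases huv : Disjoint u v
      · simp [-Finsupp.single_mul, monMul, monPartial, partialD_single, huv, hu, hv]
      · simp [-Finsupp.single_mul, monMul, monPartial, huv, hu, hv]

/-- `∂_r` is a superderivation of parity `μ(r)`. -/
theorem partialD_mul (r : Y n) {k : ℕ} {f : O F n} (hf : f ∈ parityPart F n k) (g : O F n) :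
    partialD F n r (mul F n f g) =
      mul F n (partialD F n r f) g + (-1 : F) ^ (mu r * k) • mul F n f (partialD F n r g) := by
  refine parity_induction (P := fun f => partialD F n r (mul F n f g) =
      mul F n (partialD F n r f) g + (-1 : F) ^ (mu r * k) • mul F n f (partialD F n r g))
    (by simp) (fun f₁ f₂ h₁ h₂ => ?_) (fun a x ha => ?_) hf
  · simp only [map_add, LinearMap.add_apply, h₁, h₂, smul_add]
    abel
  induction g using Finsupp.induction_linear with
  | zero => simp
  | add f₁ f₂ h₁ h₂ =>
    simp only [map_add, h₁, h₂, smul_add]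
    abel
  | single b y =>
    have hx : (Finsupp.single a x : O F n) = x • Finsupp.single a 1 := by simp
    have hy : (Finsupp.single b y : O F n) = y • Finsupp.single b 1 := by simp
    have key : partialD F n r (monMul F a b) =
        mul F n (monPartial F r a) (Finsupp.single b 1) +
          (-1 : F) ^ (mu r * k) • mul F n (Finsupp.single a 1) (monPartial F r b) := by
      cases r with
      | inl i => simpa [mu] using leibniz_inl (F := F) i a b
      | inr i => simpa [mu, neg_one_pow_eq (F := F) ha] using leibniz_inr (F := F) i a b
    rw [mul_single, map_smul, key, partialD_single, partialD_single, hx, hy]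
    simp only [map_smul, LinearMap.smul_apply, smul_add, smul_smul]
    congr 2 <;> ring

theorem natCast_choose_eq_zero (p : ℕ) [hp : Fact p.Prime] [CharP F p] {a b t : ℕ}
    (ha : a < p ^ t) (hb : b < p ^ t) (h : p ^ t ≤ a + b) : ((a + b).choose a : F) = 0 := by
  rw [CharP.cast_eq_zero_iff F p]
  have ht : 1 ≤ t := by
    rcases t with _ | t
    · simp at ha hb h; omega
    · omega
  refine Nat.dvd_of_factorization_pos (Nat.ne_of_gt ?_)
  rw [add_comm, Nat.factorization_choose' hp.out (Nat.lt_succ_self _)]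
  refine Finset.card_pos.2 ⟨t, ?_⟩
  rw [Finset.mem_filter, Finset.mem_Ico, Nat.mod_eq_of_lt ha, Nat.mod_eq_of_lt hb]
  refine ⟨⟨ht, Nat.lt_succ_of_le ?_⟩, h⟩
  exact Nat.le_log_of_pow_le hp.out.one_lt (by omega)

theorem truncated_induction {p : ℕ} {t : Fin n → ℕ} {P : O F n → Prop} (h0 : P 0)
    (hadd : ∀ f g, P f → P g → P (f + g))
    (hs : ∀ (a : Mon n) (x : F), (∀ i, a.1 i < p ^ t i) → P (Finsupp.single a x))
    {f : O F n} (hf : f ∈ truncated F p t) : P f := by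
  have hf' : ∀ a ∈ f.support, ∀ i, a.1 i < p ^ t i := fun a ha => hf ha
  rw [← Finsupp.sum_single f, Finsupp.sum]
  exact Finset.sum_induction _ P hadd h0 fun a ha => hs a _ (hf' a ha)

theorem single_mem_truncated {p : ℕ} {t : Fin n → ℕ} {a : Mon n} (x : F)
    (h : ∀ i, a.1 i < p ^ t i) : Finsupp.single a x ∈ truncated F p t :=
  Finsupp.single_mem_supported F x h

/-- `𝒪(n,n;t)` is closed under multiplication. -/
theorem mul_mem_truncated {p : ℕ} [Fact p.Prime] [CharP F p] {t : Fin n → ℕ} {f g : O F n}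
    (hf : f ∈ truncated F p t) (hg : g ∈ truncated F p t) : mul F n f g ∈ truncated F p t := by
  refine truncated_induction (P := fun f => mul F n f g ∈ truncated F p t)
    (by simp) (fun f₁ f₂ h₁ h₂ => by simpa using add_mem h₁ h₂) (fun a x ha => ?_) hf
  refine truncated_induction (P := fun g => mul F n (Finsupp.single a x) g ∈ truncated F p t)
    (by simp) (fun f₁ f₂ h₁ h₂ => by simpa using add_mem h₁ h₂) (fun b y hb => ?_) hg
  rw [mul_single, monMul]
  split_ifs
  · refine Submodule.smul_mem _ _ ?_
    by_cases h : ∀ i, a.1 i + b.1 i < p ^ t i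
    · exact single_mem_truncated _ h
    · push Not at h
      obtain ⟨i, hi⟩ := h
      have h0 : (mchoose a.1 b.1 : F) = 0 := by
        rw [mchoose, Nat.cast_prod]
        exact Finset.prod_eq_zero (Finset.mem_univ i)
          (natCast_choose_eq_zero p (ha i) (hb i) hi)
      simp [h0]
  · simp

theorem partialD_mem_truncated {p : ℕ} {t : Fin n → ℕ} {f : O F n} (r : Y n)
    (hf : f ∈ truncated F p t) : partialD F n r f ∈ truncated F p t := by
  refine truncated_induction (P := fun f => partialD F n r f ∈ truncated F p t)
    (by simp) (fun f₁ f₂ h₁ h₂ => by simpa using add_mem h₁ h₂) (fun a x ha => ?_) hf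
  rw [partialD_single]
  refine Submodule.smul_mem _ _ ?_
  cases r with
  | inl i =>
    simp only [monPartial]
    split_ifs
    · simp
    · exact single_mem_truncated _ fun j => lt_of_le_of_lt (Nat.sub_le _ _) (ha j)
  | inr k =>
    simp only [monPartial]
    split_ifs
    · exact single_mem_truncated _ ha
    · simp

/-- The superderivations `∂_r` super-commute. -/
theorem partialD_comm (r s : Y n) (f : O F n) :
    partialD F n r (partialD F n s f) =
      (-1 : F) ^ (mu r * mu s) • partialD F n s (partialD F n r f) := by
  induction f using Finsupp.induction_linear with
  | zero => simp
  | add f₁ f₂ h₁ h₂ => simp [h₁, h₂]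
  | single a x =>
  simp only [partialD_single, map_smul]
  rw [smul_comm]
  congr 1
  obtain ⟨α, u⟩ := a
  cases r with
  | inl i =>
    cases s with
    | inl j =>
      by_cases hij : i = j
      · subst hij; simp [mu]
      · have hji : ¬ j = i := fun h => hij h.symm
        simp only [monPartial, mu, mul_zero, pow_zero, one_smul]
        by_cases hi : α i = 0 <;> by_cases hj : α j = 0 <;>
          simp [hi, hj, hij, hji, partialD_single, monPartial, tsub_right_comm]
    | inr l =>
      simp only [monPartial, mu, zero_mul, pow_zero, one_smul]
      by_cases hi : α i = 0 <;> by_cases hl : l ∈ u <;>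
        simp [hi, hl, partialD_single, monPartial]
  | inr k =>
    cases s with
    | inl j =>
      simp only [monPartial, mu, mul_zero, pow_zero, one_smul]
      by_cases hj : α j = 0 <;> by_cases hk : k ∈ u <;>
        simp [hj, hk, partialD_single, monPartial]
    | inr l =>
      have key : ∀ (w : Finset (Fin n)) (k l : Fin n), l < k → k ∈ w → l ∈ w →
          ((w.erase k).filter fun j => j < l).card = (w.filter fun j => j < l).card ∧
          (w.filter fun j => j < k).card = ((w.erase l).filter fun j => j < k).card + 1 := by
        intro w k l hlk hk hl
        constructor
        · rw [Finset.filter_erase, Finset.erase_eq_of_notMem]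
          simp [hlk.le]
        · rw [Finset.filter_erase, Finset.card_erase_add_one]
          simp [hl, hlk]
      simp only [monPartial, mu, mul_one, pow_one]
      by_cases hk : k ∈ u
      · by_cases hl : l ∈ u
        · by_cases hkl : k = l
          · subst hkl
            simp [hk, partialD_single, monPartial]
          · have hlk : ¬ l = k := fun h => hkl h.symm
            simp only [hk, hl, if_true, partialD_single, monPartial, Finset.mem_erase, ne_eq, hkl,
              hlk, not_false_eq_true, and_self, Finsupp.smul_single, smul_eq_mul,
              Finset.erase_right_comm (a := l) (b := k)]
            congr 1
            rcases lt_or_gt_of_ne hkl with h | h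
            · obtain ⟨e1, e2⟩ := key u l k h hl hk
              rw [e1, e2]; ring
            · obtain ⟨e1, e2⟩ := key u k l h hk hl
              rw [e1, e2]; ring
        · simp [hk, hl, partialD_single, monPartial]
      · simp only [hk, if_false, map_zero, smul_zero]
        split_ifs <;> simp [hk, partialD_single, monPartial]

theorem mu_swap (r : Y n) : (mu r.swap : ZMod 2) = 1 + mu r := by
  cases r with
  | inl i => simp [mu]
  | inr i => simp only [Sum.swap_inr, mu]; rfl

theorem TH_of_parity {k : ℕ} {a : O F n} (ha : a ∈ parityPart F n k) :
    TH F n a = ∑ i : Y n, (-1 : F) ^ (mu i * k) • vf F n (partialD F n i a) i.swap := by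
  refine parity_induction (P := fun a => TH F n a =
    ∑ i : Y n, (-1 : F) ^ (mu i * k) • vf F n (partialD F n i a) i.swap) ?_ ?_ ?_ ha
  · simp [vf]
  · intro f g hf hg
    rw [map_add, hf, hg, ← Finset.sum_add_distrib]
    refine Finset.sum_congr rfl fun i _ => ?_
    simp [vf, LinearMap.add_comp]
  · intro b x hb
    rw [TH, Finsupp.linearCombination_single, Finset.smul_sum]
    refine Finset.sum_congr rfl fun i _ => ?_
    have e : (-1 : F) ^ (mu i * b.2.card) = (-1) ^ (mu i * k) :=
      neg_one_pow_eq (by push_cast; rw [hb])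
    have hx : (Finsupp.single b x : O F n) = x • Finsupp.single b 1 := by simp
    rw [e, hx, map_smul, vf, vf, map_smul, LinearMap.smul_comp, smul_comm]

theorem TH_apply {k : ℕ} {a : O F n} (ha : a ∈ parityPart F n k) (h : O F n) :
    TH F n a h = ∑ i : Y n, (-1 : F) ^ (mu i * k) •
      mul F n (partialD F n i a) (partialD F n i.swap h) := by
  rw [TH_of_parity ha]
  simp [vf]

/-- `T_H` is an odd map. -/
theorem TH_mem_parityPart {k : ℕ} {a : O F n} (ha : a ∈ parityPart F n k) {θ : ZMod 2}
    {f : O F n} (hf : f ∈ parityPart F n θ) : TH F n a f ∈ parityPart F n (θ + k + 1) := by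
  rw [TH_apply ha]
  refine Submodule.sum_mem _ fun i _ => Submodule.smul_mem _ _ ?_
  have := mul_mem_parityPart (partialD_mem_parityPart i ha) (partialD_mem_parityPart i.swap hf)
  rw [mu_swap] at this
  have e : (k : ZMod 2) + mu i + (θ + (1 + mu i)) = θ + k + 1 := by
    have : (2 : ZMod 2) = 0 := rfl
    linear_combination (mu i : ZMod 2) * this
  rwa [e] at this

theorem TH_mem_truncated {p : ℕ} [Fact p.Prime] [CharP F p] {t : Fin n → ℕ} {k : ℕ} {a f : O F n}
    (hk : a ∈ parityPart F n k) (ha : a ∈ truncated F p t) (hf : f ∈ truncated F p t) :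
    TH F n a f ∈ truncated F p t := by
  rw [TH_apply hk]
  exact Submodule.sum_mem _ fun i _ => Submodule.smul_mem _ _
    (mul_mem_truncated (partialD_mem_truncated i ha) (partialD_mem_truncated i.swap hf))

theorem sign_swap (i : Y n) : (-1 : F) ^ mu i.swap = -(-1) ^ mu i := by
  cases i <;> simp [mu]

theorem sum_swap (f : Y n → O F n) : ∑ i, f i = ∑ i : Y n, f i.swap :=
  (Equiv.sum_comp (Equiv.sumComm (Fin n) (Fin n)) f).symm

theorem TH_odd_apply {a : O F n} (ha : a ∈ parityPart F n 1) (h : O F n) :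
    TH F n a h = ∑ i : Y n, (-1 : F) ^ mu i •
      mul F n (partialD F n i a) (partialD F n i.swap h) := by
  have ha' : a ∈ parityPart F n ((1 : ℕ) : ZMod 2) := by simpa using ha
  rw [TH_apply ha']
  simp

/-- For odd `a`, the operator `T_H(a)` is an even derivation. -/
theorem TH_odd_mul {a : O F n} (ha : a ∈ parityPart F n 1) (g h : O F n) :
    TH F n a (mul F n g h) = mul F n (TH F n a g) h + mul F n g (TH F n a h) := by
  induction g using Finsupp.induction_linear with
  | zero => simp
  | add f₁ f₂ h₁ h₂ =>
    simp only [map_add, LinearMap.add_apply, h₁, h₂]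
    abel
  | single b x =>
  have hb : (Finsupp.single b x : O F n) ∈ parityPart F n (b.2.card : ℕ) :=
    single_mem_parityPart x rfl
  simp only [TH_odd_apply ha, map_sum, LinearMap.sum_apply, map_smul, LinearMap.smul_apply]
  rw [← Finset.sum_add_distrib]
  refine Finset.sum_congr rfl fun i _ => ?_
  rw [← smul_add]
  congr 1
  have hi : partialD F n i a ∈ parityPart F n (mu i.swap : ℕ) := by
    rw [mu_swap]; exact partialD_mem_parityPart i ha
  rw [partialD_mul _ hb, map_add, map_smul, ← mul_assoc', ← mul_assoc', ← mul_assoc',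
    mul_supercomm hi hb, map_smul, LinearMap.smul_apply, smul_smul, ← mul_pow]
  simp

/-- The super-commutator of `∂_s` and `T_H(a)`, for odd `a`. -/
theorem partialD_TH {a : O F n} (ha : a ∈ parityPart F n 1) (s : Y n) (h : O F n) :
    partialD F n s (TH F n a h) = TH F n a (partialD F n s h) +
      ∑ i : Y n, (-1 : F) ^ mu i •
        mul F n (partialD F n s (partialD F n i a)) (partialD F n i.swap h) := by
  simp only [TH_odd_apply ha, map_sum, map_smul]
  rw [← Finset.sum_add_distrib]
  refine Finset.sum_congr rfl fun i _ => ?_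
  have hi : partialD F n i a ∈ parityPart F n (mu i.swap : ℕ) := by
    rw [mu_swap]; exact partialD_mem_parityPart i ha
  rw [partialD_mul s hi, partialD_comm s i.swap h, map_smul, smul_smul, ← pow_add, ← smul_add,
    add_comm]
  congr 2
  rw [← two_mul, pow_mul]
  simp

/-- `[T_H(a), T_H(b)] = T_H(T_H(a)(b))` for odd `a` and `b`. -/
theorem TH_comm {a b : O F n} (ha : a ∈ parityPart F n 1) (hb : b ∈ parityPart F n 1) :
    TH F n a * TH F n b - TH F n b * TH F n a = TH F n (TH F n a b) := by
  have hc : TH F n a b ∈ parityPart F n 1 := by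
    have ha' : a ∈ parityPart F n ((1 : ℕ) : ZMod 2) := by simpa using ha
    have := TH_mem_parityPart ha' hb
    have e : (1 : ZMod 2) + ((1 : ℕ) : ZMod 2) + 1 = 1 := rfl
    rwa [e] at this
  ext1 m
  ext1
  simp only [LinearMap.comp_apply, Finsupp.lsingle_apply]
  generalize (Finsupp.single m 1 : O F n) = h
  simp only [LinearMap.sub_apply, Module.End.mul_apply]
  rw [TH_odd_apply hc, TH_odd_apply hb h, TH_odd_apply hb (TH F n a h)]
  simp only [partialD_TH ha, TH_odd_mul ha, map_sum, map_smul, map_add, smul_add,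
    LinearMap.add_apply, LinearMap.sum_apply, LinearMap.smul_apply, Finset.sum_add_distrib]
  have key : (∑ x : Y n, (-1 : F) ^ mu x • ∑ y : Y n, (-1 : F) ^ mu y •
      mul F n (partialD F n x b) (mul F n (partialD F n x.swap (partialD F n y a))
        (partialD F n y.swap h))) =
      -∑ x : Y n, (-1 : F) ^ mu x • ∑ y : Y n, (-1 : F) ^ mu y •
      mul F n (mul F n (partialD F n x (partialD F n y a)) (partialD F n y.swap b))
        (partialD F n x.swap h) := by
    simp only [Finset.smul_sum, ← Finset.sum_neg_distrib]
    rw [Finset.sum_comm]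
    refine Finset.sum_congr rfl fun x _ => ?_
    rw [sum_swap]
    refine Finset.sum_congr rfl fun y _ => ?_
    rw [Sum.swap_swap, sign_swap, ← mul_assoc']
    have h1 : partialD F n y.swap b ∈ parityPart F n (mu y : ℕ) := by
      have := partialD_mem_parityPart y.swap hb
      rw [mu_swap] at this
      have e : (1 : ZMod 2) + (1 + mu y) = mu y := by
        have : (2 : ZMod 2) = 0 := rfl
        linear_combination this
      rwa [e] at this
    have h2 : partialD F n y (partialD F n x a) ∈
        parityPart F n ((1 + mu x + mu y : ℕ) : ZMod 2) := by
      have := partialD_mem_parityPart y (partialD_mem_parityPart x ha)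
      push_cast
      exact this
    rw [mul_supercomm h1 h2, partialD_comm y x a]
    simp only [map_smul, LinearMap.smul_apply, smul_smul]
    rw [← neg_smul]
    congr 1
    cases x <;> cases y <;> norm_num [mu]
  rw [key]
  abel

theorem TH_mem_evenEnd {a : O F n} (ha : a ∈ parityPart F n 1) : TH F n a ∈ evenEnd F n := by
  intro θ f hf
  have ha' : a ∈ parityPart F n ((1 : ℕ) : ZMod 2) := by simpa using ha
  have := TH_mem_parityPart ha' hf
  have e : θ + ((1 : ℕ) : ZMod 2) + 1 = θ := by
    have : (2 : ZMod 2) = 0 := rfl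
    push_cast
    linear_combination this
  rwa [e] at this

theorem eq_zero_of_mem_parityPart {θ : ZMod 2} {f : O F n} (h0 : f ∈ parityPart F n θ)
    (h1 : f ∈ parityPart F n (θ + 1)) : f = 0 := by
  ext a
  by_contra h
  have ha : a ∈ f.support := Finsupp.mem_support_iff.2 h
  have e0 : (a.2.card : ZMod 2) = θ := h0 ha
  have e1 : (a.2.card : ZMod 2) = θ + 1 := h1 ha
  rw [e0] at e1
  exact one_ne_zero (left_eq_add.1 e1)

/-- The even elements of `HO(n,n;t)` are the `T_H(a)` with `a` odd. -/
theorem mem_HO_inf_evenEnd {p : ℕ} {t : Fin n → ℕ} {D : Module.End F (O F n)} :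
    D ∈ HO F p t ⊓ evenEnd F n ↔
      ∃ a ∈ truncated F p t, a ∈ parityPart F n 1 ∧ TH F n a = D := by
  constructor
  · rintro ⟨⟨a, ha, rfl⟩, he⟩
    have hd : ∀ m : Mon n, (m.2.card : ZMod 2) ≠ 1 → (m.2.card : ZMod 2) = 0 := by
      intro m
      generalize (m.2.card : ZMod 2) = z
      revert z
      decide
    let a₁ : O F n := a.filter fun m => (m.2.card : ZMod 2) = 1
    let a₀ : O F n := a.filter fun m => ¬ (m.2.card : ZMod 2) = 1
    have hsum : a₁ + a₀ = a := Finsupp.filter_add_filter_not _ _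
    have h₁ : a₁ ∈ parityPart F n 1 := fun m hm => (Finset.mem_filter.1 hm).2
    have h₀ : a₀ ∈ parityPart F n ((0 : ℕ) : ZMod 2) := fun m hm => by
      have := hd m (Finset.mem_filter.1 hm).2
      simpa using this
    refine ⟨a₁, fun m hm => ha (Finset.mem_filter.1 hm).1, h₁, ?_⟩
    have hz : TH F n a₀ = 0 := by
      have hev : TH F n a₀ ∈ evenEnd F n := by
        intro θ f hf
        have e : TH F n a₀ f = TH F n a f - TH F n a₁ f := by
          rw [← hsum, map_add, LinearMap.add_apply, add_sub_cancel_left]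
        rw [e]
        exact Submodule.sub_mem _ (he θ f hf) (TH_mem_evenEnd h₁ θ f hf)
      ext1 m
      ext1
      simp only [LinearMap.comp_apply, Finsupp.lsingle_apply, LinearMap.zero_apply]
      have hm : (Finsupp.single m 1 : O F n) ∈ parityPart F n (m.2.card : ZMod 2) :=
        single_mem_parityPart 1 rfl
      refine eq_zero_of_mem_parityPart (hev _ _ hm) ?_
      have := TH_mem_parityPart h₀ hm
      simpa using this
    rw [← hsum, map_add, hz, add_zero]
  · rintro ⟨a, ha, h1, rfl⟩
    exact ⟨⟨a, ha, rfl⟩, TH_mem_evenEnd h1⟩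

attribute [local instance 100] LieRing.ofAssociativeRing

/-- The Lie algebra `𝓗𝓞`, the even part of `HO(n,n;t)`, with the commutator of operators as
bracket. -/
def evenHO (F : Type*) [Field F] (p : ℕ) [Fact p.Prime] [CharP F p] {n : ℕ} (t : Fin n → ℕ) :
    LieSubalgebra F (Module.End F (O F n)) :=
  { HO F p t ⊓ evenEnd F n with
    lie_mem' := by
      intro D E hD hE
      change D ∈ HO F p t ⊓ evenEnd F n at hD
      change E ∈ HO F p t ⊓ evenEnd F n at hE
      change ⁅D, E⁆ ∈ HO F p t ⊓ evenEnd F n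
      obtain ⟨a, hat, ha, rfl⟩ := mem_HO_inf_evenEnd.1 hD
      obtain ⟨b, hbt, hb, rfl⟩ := mem_HO_inf_evenEnd.1 hE
      have ha' : a ∈ parityPart F n ((1 : ℕ) : ZMod 2) := by simpa using ha
      exact mem_HO_inf_evenEnd.2 ⟨TH F n a b, TH_mem_truncated ha' hat hbt,
        TH_mem_evenEnd ha 1 b hb, (TH_comm ha hb).symm⟩ }

/-- The outer derivation algebra `Der(L) / ad(L)` of a Lie algebra `L`. -/
abbrev OuterDer (R L : Type*) [CommRing R] [LieRing L] [LieAlgebra R L] : Type _ :=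
  LieDerivation R L L ⧸ (LieDerivation.ad R L).idealRange

end

end OddHamiltonian

/-!
Write `ξ_i` for `x_{i'}`. The elements of `𝓗𝓞` are the `T_H(a)` with `a` odd, and `T_H` is
injective there, so `𝓗𝓞` has the basis `T_H(x^(α) x^u)` with `|u|` odd. Bracketing with `ξ_i` gives
`-∂_i`, and the `x_i ξ_i` act diagonally, with weights that determine `u` when `α = 0`.

A derivation `D` is first corrected by inner derivations. The values `D ξ_i` satisfy the
integrability condition `∂_j D ξ_i = ∂_i D ξ_j`, so they come from a potential, and the weights rule
out the potentials outside the truncated algebra; the same weights then correct the values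
`D(x_i ξ_i)`. The corrected `D` kills all `ξ_i` and `x_i ξ_i`, hence commutes with the `∂_i` and
preserves weights. If it kills the basis elements below `x^(α) x^u`, then its value there is
constant in the even variables and has the weight of `x^(α) x^u`, which leaves few possibilities.
Writing monomials as brackets shows inductively that `D` is determined by its coefficients at
`x_i^(p^v) ξ_i`, `0 < v < t_i`, and at one trivector `x^{s₀}`. The derivations `∂_i^(p^v)` and the
degree derivation realise these coefficients independently, and they commute.
-/

namespace OddHamiltonian

noncomputable section

theorem single_one_le {ι : Type*} [DecidableEq ι] {α : ι → ℕ} {i : ι} (h : α i ≠ 0) :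
    Pi.single i 1 ≤ α :=
  update_le_iff.2 ⟨Nat.one_le_iff_ne_zero.2 h, fun _ _ => Nat.zero_le _⟩

theorem sub_single_add_single {ι : Type*} [DecidableEq ι] {α : ι → ℕ} {i : ι} (h : α i ≠ 0) :
    α - Pi.single i 1 + Pi.single i 1 = α :=
  tsub_add_cancel_of_le (single_one_le h)

theorem sub_single_lt {ι : Type*} [DecidableEq ι] {α : ι → ℕ} {i : ι} (h : α i ≠ 0) :
    α - Pi.single i 1 < α :=
  lt_of_le_of_ne tsub_le_self fun e => by
    have hi := congrFun e i
    simp only [Pi.sub_apply, Pi.single_eq_same] at hi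
    omega

theorem exists_potential {ι M : Type*} [DecidableEq ι] [Nonempty M] (g : ι → (ι → ℕ) → M)
    (hg : ∀ i j (α : ι → ℕ), g i (α + Pi.single j 1) = g j (α + Pi.single i 1)) :
    ∃ f : (ι → ℕ) → M, ∀ i α, f (α + Pi.single i 1) = g i α := by
  classical
  let f : (ι → ℕ) → M := fun α =>
    if h : ∃ i, α i ≠ 0 then g h.choose (α - Pi.single h.choose 1)
    else Classical.arbitrary M
  refine ⟨f, fun i α => ?_⟩
  have h : ∃ j, (α + Pi.single i 1 : ι → ℕ) j ≠ 0 := ⟨i, by simp⟩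
  rw [show f _ = _ from dif_pos h]
  have hj := h.choose_spec
  generalize h.choose = j at hj
  obtain rfl | hji := eq_or_ne j i
  · rw [add_tsub_cancel_right]
  · have hα : α j ≠ 0 := by simpa [hji] using hj
    rw [← tsub_add_eq_add_tsub (single_one_le hα), hg, sub_single_add_single hα]

theorem exchange_induction {ι : Type*} [DecidableEq ι] {P : Finset ι → Prop} {s₀ : Finset ι}
    (base : P s₀) (exchange : ∀ s, ∀ j ∈ s, ∀ i ∉ s, P s → P (insert i (s.erase j)))
    {s : Finset ι} (hs : s.card = s₀.card) : P s := by
  induction h : (s \ s₀).card generalizing s with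
  | zero =>
    rwa [Finset.eq_of_subset_of_card_le (Finset.sdiff_eq_empty_iff_subset.1
      (Finset.card_eq_zero.1 h)) hs.ge]
  | succ m ih =>
    obtain ⟨i, hi⟩ := Finset.card_pos.1 (h.ge.trans_lt' m.succ_pos)
    obtain ⟨j, hj⟩ : (s₀ \ s).Nonempty := by
      rw [← Finset.card_pos, ← Finset.card_sdiff_comm hs]
      exact h.ge.trans_lt' m.succ_pos
    rw [Finset.mem_sdiff] at hi hj
    have hj' : j ∉ s.erase i := fun hm => hj.2 (Finset.mem_of_mem_erase hm)
    have hsdiff : insert j (s.erase i) \ s₀ = (s \ s₀).erase i := by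
      rw [Finset.insert_sdiff_of_mem _ hj.1, Finset.erase_sdiff_comm]
    have hP := exchange _ j (Finset.mem_insert_self j (s.erase i)) i
      (by simp only [Finset.mem_insert, Finset.notMem_erase, or_false]; rintro rfl; exact hj.2 hi.1)
      (ih (by rw [Finset.card_insert_of_notMem hj', Finset.card_erase_add_one hi.1, hs])
        (by rw [hsdiff, Finset.card_erase_of_mem (Finset.mem_sdiff.2 hi), h, Nat.add_sub_cancel]))
    rwa [Finset.erase_insert hj', Finset.insert_erase hi.1] at hP

theorem exists_choose_ne_choose_pred (F : Type*) [Ring F] {p : ℕ} [Fact p.Prime] [CharP F p]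
    {N : ℕ} (hN : N ≠ 0) (hp : (N : F) = 0) (hpow : ∀ v, N ≠ p ^ v) :
    ∃ q, 1 < q ∧ q < N ∧ (N.choose q : F) ≠ N.choose (q - 1) := by
  by_contra! hq
  have hzero : ∀ k, k + 1 < N → (N.choose (k + 1) : F) = 0 := by
    intro k
    induction k with
    | zero => simpa using fun _ => hp
    | succ k ih => exact fun hk => (hq _ (by omega) hk).trans (ih (by omega))
  refine hpow _ (Choose.eq_pow_multiplicity_of_choose_modEq_zero_nat (Nat.pos_of_ne_zero hN)
    fun i hi => ?_)
  obtain ⟨hi₁, hi₂⟩ := Finset.mem_Icc.1 hi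
  rw [Nat.modEq_zero_iff_dvd, ← CharP.cast_eq_zero_iff F p, ← Nat.sub_add_cancel hi₁]
  exact hzero _ (by omega)

section LieDerivation

variable {R L : Type*} [CommRing R] [LieRing L] [LieAlgebra R L]

theorem derivation_lie_eq_zero (D : LieDerivation R L L) {x y : L} (hx : D x = 0) (hy : D y = 0) :
    D ⁅x, y⁆ = 0 := by
  rw [D.apply_lie_eq_sub, hx, hy, lie_zero, lie_zero, sub_zero]

theorem derivation_eq_zero_of_lie_eq_smul {K : Type*} [Field K] [LieAlgebra K L]
    (D : LieDerivation K L L) {x y z : L} {c : K} (hx : D x = 0) (hy : D y = 0) (hc : c ≠ 0)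
    (h : ⁅x, y⁆ = c • z) : D z = 0 := by
  have hz := derivation_lie_eq_zero D hx hy
  rw [h, map_smul] at hz
  exact (smul_eq_zero.1 hz).resolve_left hc

/-- The iterate `D^(p^v)` of a derivation in characteristic `p`, which is again a derivation. -/
def powDerivation (p : ℕ) [Fact p.Prime] [CharP R p] (D : LieDerivation R L L) (v : ℕ) :
    LieDerivation R L L where
  toLinearMap := (D : Module.End R L) ^ p ^ v
  leibniz' x y := by
    have hpow (z : L) : ((D : Module.End R L) ^ p ^ v) z = D^[p ^ v] z := Module.End.pow_apply ..
    rw [hpow, hpow, hpow, ← lie_skew y, sub_neg_eq_add, D.iterate_apply_lie', Finset.sum_range_succ,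
      Finset.sum_eq_single_of_mem 0 (Finset.mem_range.2 (pow_pos (Fact.out : p.Prime).pos v))]
    · simp
    · intro i hi hi0
      have hchoose : ((p ^ v).choose i : R) = 0 := (CharP.cast_eq_zero_iff R p _).2
        ((Fact.out : p.Prime).dvd_choose_pow hi0 (Finset.mem_range.1 hi).ne)
      rw [← Nat.cast_smul_eq_nsmul R, hchoose, zero_smul]

theorem powDerivation_apply (p : ℕ) [Fact p.Prime] [CharP R p] (D : LieDerivation R L L) (v : ℕ)
    (x : L) : powDerivation p D v x = D^[p ^ v] x :=
  Module.End.pow_apply ..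

theorem isLieAbelian_quotient_of_codisjoint (I : LieIdeal R L) (N : Submodule R L)
    (hIN : Codisjoint I.toSubmodule N) (hN : ∀ x ∈ N, ∀ y ∈ N, ⁅x, y⁆ = 0) :
    IsLieAbelian (L ⧸ I) := by
  have hrep : ∀ q : L ⧸ I, ∃ x ∈ N, LieSubmodule.Quotient.mk x = q := by
    intro q
    obtain ⟨x, rfl⟩ := LieSubmodule.Quotient.surjective_mk' I q
    obtain ⟨y, hy, z, hz, rfl⟩ := Submodule.mem_sup.1 (hIN.eq_top ▸ Submodule.mem_top (x := x))
    refine ⟨z, hz, ?_⟩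
    simpa using hy
  refine ⟨fun q r => ?_⟩
  obtain ⟨x, hx, rfl⟩ := hrep q
  obtain ⟨y, hy, rfl⟩ := hrep r
  rw [← LieSubmodule.Quotient.mk_bracket, hN x hx y hy]
  rfl

end LieDerivation

/-! ### Brackets of monomials -/

variable {F : Type*} [Field F] {n : ℕ}

theorem partialD_inl_apply (i : Fin n) (f : O F n) (a : Mon n) :
    partialD F n (Sum.inl i) f a = f (a.1 + Pi.single i 1, a.2) := by
  induction f using Finsupp.induction_linear with
  | zero => simp
  | add f g hf hg => simp [hf, hg]
  | single b x =>
    rw [partialD_single, monPartial]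
    split_ifs with h
    · have hb : b ≠ (a.1 + Pi.single i 1, a.2) := by rintro rfl; simp at h
      simp [hb]
    · have hb : (b.1 - Pi.single i 1, b.2) = a ↔ b = (a.1 + Pi.single i 1, a.2) := by
        simp only [Prod.ext_iff, ← tsub_eq_iff_eq_add_of_le (single_one_le h)]
      simp [Finsupp.single_apply, hb]

theorem partialD_inl_add_single (i : Fin n) (α : Fin n → ℕ) (u : Finset (Fin n)) :
    partialD F n (Sum.inl i) (Finsupp.single (α + Pi.single i 1, u) 1) =
      Finsupp.single (α, u) 1 := by
  simp [partialD_single, monPartial]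

theorem partialD_inl_single_pow (i : Fin n) (m : ℕ) (u : Finset (Fin n)) :
    partialD F n (Sum.inl i) (Finsupp.single (Pi.single i (m + 1), u) 1) =
      Finsupp.single (Pi.single i m, u) 1 := by
  simpa [Pi.single_add] using partialD_inl_add_single (F := F) i (Pi.single i m) u

theorem partialD_inl_eq_zero {i : Fin n} {a : Mon n} (h : a.1 i = 0) (x : F) :
    partialD F n (Sum.inl i) (Finsupp.single a x) = 0 := by
  simp [partialD_single, monPartial, h]

theorem partialD_inr_eq_zero {i : Fin n} {a : Mon n} (h : i ∉ a.2) (x : F) :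
    partialD F n (Sum.inr i) (Finsupp.single a x) = 0 := by
  simp [partialD_single, monPartial, h]

theorem partialD_inr_singleton (i : Fin n) (α : Fin n → ℕ) :
    partialD F n (Sum.inr i) (Finsupp.single (α, {i}) 1) = Finsupp.single (α, ∅) 1 := by
  simp [partialD_single, monPartial, Finset.filter_singleton]

theorem partialD_inr_apply_erase {k : Fin n} (f : O F n) {a : Mon n} (hk : k ∈ a.2) :
    partialD F n (Sum.inr k) f (a.1, a.2.erase k) =
      (-1) ^ (a.2.filter fun j => j < k).card * f a := by
  induction f using Finsupp.induction_linear with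
  | zero => simp
  | add f g hf hg => simp [hf, hg, mul_add]
  | single b x =>
    rw [partialD_single, monPartial]
    split_ifs with h
    · obtain rfl | hba := eq_or_ne b a
      · simp [mul_comm]
      · have hb : (b.1, b.2.erase k) ≠ (a.1, a.2.erase k) := fun e => hba <| by
          obtain ⟨e₁, e₂⟩ := Prod.mk.inj e
          exact Prod.ext e₁ (by rw [← Finset.insert_erase h, e₂, Finset.insert_erase hk])
        simp [hb, hba]
    · have hb : b ≠ a := by rintro rfl; exact h hk
      simp [hb]

theorem mchoose_zero_left (β : Fin n → ℕ) : mchoose 0 β = 1 := by simp [mchoose]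

theorem mchoose_single_left (i : Fin n) (m : ℕ) (β : Fin n → ℕ) :
    mchoose (Pi.single i m) β = (m + β i).choose m := by
  rw [mchoose, Finset.prod_eq_single i]
  · simp
  · intro j _ hj
    simp [hj]
  · simp

theorem mul_one_left (f : O F n) : mul F n (Finsupp.single (0, ∅) 1) f = f := by
  induction f using Finsupp.induction_linear with
  | zero => simp
  | add f g hf hg => simp [hf, hg]
  | single b x => simp [-Finsupp.single_mul, mul_single, monMul, mchoose_zero_left, inv]

theorem mul_one_right (f : O F n) : mul F n f (Finsupp.single (0, ∅) 1) = f := by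
  induction f using Finsupp.induction_linear with
  | zero => simp
  | add f g hf hg => simp [hf, hg]
  | single b x =>
    simp [-Finsupp.single_mul, mul_single, monMul, mchoose_comm b.1, mchoose_zero_left, inv]

theorem mul_single_pow (i : Fin n) (m : ℕ) (a : Mon n) :
    mul F n (Finsupp.single (Pi.single i m, ∅) 1) (Finsupp.single a 1) =
      ((m + a.1 i).choose m : F) • Finsupp.single (Pi.single i m + a.1, a.2) 1 := by
  simp [-Finsupp.single_mul, mul_single, monMul, mchoose_single_left, inv]

theorem single_odd {a : Mon n} (h : Odd a.2.card) (x : F) :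
    (Finsupp.single a x : O F n) ∈ parityPart F n 1 :=
  single_mem_parityPart x ((ZMod.natCast_eq_one_iff_odd).2 h)

theorem TH_odd_eq_sum {a : O F n} (ha : a ∈ parityPart F n 1) (f : O F n) :
    TH F n a f = ∑ k : Fin n,
      (mul F n (partialD F n (Sum.inl k) a) (partialD F n (Sum.inr k) f) -
        mul F n (partialD F n (Sum.inr k) a) (partialD F n (Sum.inl k) f)) := by
  rw [TH_odd_apply ha, Fintype.sum_sum_type, Finset.sum_sub_distrib, sub_eq_add_neg,
    ← Finset.sum_neg_distrib]
  simp [mu]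

theorem TH_pow_mul_xi (i : Fin n) (m : ℕ) (f : O F n) :
    TH F n (Finsupp.single (Pi.single i m, {i}) 1) f =
      mul F n (partialD F n (Sum.inl i) (Finsupp.single (Pi.single i m, {i}) 1))
          (partialD F n (Sum.inr i) f) -
        mul F n (Finsupp.single (Pi.single i m, ∅) 1) (partialD F n (Sum.inl i) f) := by
  rw [TH_odd_eq_sum (single_odd (by simp) _), Finset.sum_eq_single i _ (by simp),
    partialD_inr_singleton]
  intro k _ hk
  rw [partialD_inl_eq_zero (by simp [hk]), partialD_inr_eq_zero (by simpa using hk)]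
  simp

theorem TH_xi (i : Fin n) (f : O F n) :
    TH F n (Finsupp.single (0, {i}) 1) f = -partialD F n (Sum.inl i) f := by
  have h := TH_pow_mul_xi i 0 f
  rwa [Pi.single_zero, partialD_inl_eq_zero rfl, map_zero, LinearMap.zero_apply, zero_sub,
    mul_one_left] at h

theorem TH_even_coordinate {a : O F n} (ha : a ∈ parityPart F n 1) (k : Fin n) :
    TH F n a (Finsupp.single (Pi.single k 1, ∅) 1) = -partialD F n (Sum.inr k) a := by
  rw [TH_odd_eq_sum ha, Finset.sum_eq_single k _ (by simp)]
  · rw [partialD_inl_single_pow, Pi.single_zero, mul_one_right,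
      partialD_inr_eq_zero (by simp), map_zero, zero_sub]
  · intro l _ hl
    rw [partialD_inl_eq_zero (by simp [hl]), partialD_inr_eq_zero (by simp), map_zero, map_zero,
      sub_zero]

theorem TH_eq_zero_iff {a : O F n} (ha : a ∈ parityPart F n 1) : TH F n a = 0 ↔ a = 0 := by
  refine ⟨fun h => ?_, fun h => by rw [h, map_zero]⟩
  ext b
  by_contra hb
  have hodd : Odd b.2.card :=
    ZMod.natCast_eq_one_iff_odd.1 (ha (Finsupp.mem_support_iff.2 hb))
  obtain ⟨k, hk⟩ := Finset.card_pos.1 hodd.pos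
  have hpartial : partialD F n (Sum.inr k) a = 0 := by
    rw [← neg_eq_zero, ← TH_even_coordinate ha, h, LinearMap.zero_apply]
  have hcoeff := partialD_inr_apply_erase a hk
  rw [hpartial] at hcoeff
  exact hb (by simpa using hcoeff.symm)

/-- The weight of a monomial: its eigenvalue under the bracket with `x_i x_{i'}`. -/
def weight (F : Type*) [Field F] {n : ℕ} (a : Mon n) (i : Fin n) : F :=
  (if i ∈ a.2 then 1 else 0) - (a.1 i : F)

theorem apply_eq_of_single_eq_smul {ι : Type*} {T : Module.End F (ι →₀ F)} {c : ι → F}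
    (h : ∀ a, T (Finsupp.single a 1) = c a • Finsupp.single a 1) (f : ι →₀ F) (a : ι) :
    T f a = c a * f a := by
  induction f using Finsupp.induction_linear with
  | zero => simp
  | add f g hf hg => simp [hf, hg, mul_add]
  | single b x =>
    rw [← mul_one x, ← smul_eq_mul, ← Finsupp.smul_single, map_smul, h]
    by_cases hba : b = a <;> simp [hba, mul_comm]

theorem xi_mul_partialD_inr (i : Fin n) (a : Mon n) :
    mul F n (Finsupp.single (0, {i}) 1) (partialD F n (Sum.inr i) (Finsupp.single a 1)) =
      (if i ∈ a.2 then 1 else 0 : F) • Finsupp.single a 1 := by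
  rw [partialD_single, monPartial]
  split_ifs with hi
  · have hdisj : Disjoint {i} (a.2.erase i) := by simp
    simp only [one_smul, mul_single, monMul, hdisj, if_true, mchoose_zero_left, zero_add,
      inv_singleton_left, Finset.filter_erase, lt_irrefl, Finset.mem_filter, and_false,
      not_false_eq_true, Finset.erase_eq_of_notMem, Finsupp.smul_single, smul_eq_mul,
      ← Finset.insert_eq, Finset.insert_erase hi, Nat.cast_one, one_mul, ← mul_pow]
    simp
  · simp

theorem x_mul_partialD_inl (i : Fin n) (a : Mon n) :
    mul F n (Finsupp.single (Pi.single i 1, ∅) 1)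
        (partialD F n (Sum.inl i) (Finsupp.single a 1)) =
      (a.1 i : F) • Finsupp.single a 1 := by
  rw [partialD_single, monPartial, one_smul]
  split_ifs with hi
  · simp [hi]
  · rw [mul_single_pow, add_comm (Pi.single i 1), sub_single_add_single hi]
    simp [Nat.add_sub_cancel' (Nat.one_le_iff_ne_zero.2 hi)]

theorem TH_cartan_apply (i : Fin n) (f : O F n) (a : Mon n) :
    TH F n (Finsupp.single (Pi.single i 1, {i}) 1) f a = weight F a i * f a := by
  refine apply_eq_of_single_eq_smul (c := (weight F · i)) (fun b => ?_) f a
  rw [TH_pow_mul_xi, partialD_inl_single_pow, Pi.single_zero, xi_mul_partialD_inr,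
    x_mul_partialD_inl, weight, sub_smul]

theorem TH_pow_mul_xi_of_ne {i k : Fin n} (hki : k ≠ i) (m : ℕ) (α : Fin n → ℕ) :
    TH F n (Finsupp.single (Pi.single i m, {i}) 1) (Finsupp.single (α + Pi.single i 1, {k}) 1) =
      -((m + α i).choose m : F) • Finsupp.single (Pi.single i m + α, {k}) 1 := by
  rw [TH_pow_mul_xi, partialD_inr_eq_zero (by simpa using hki.symm), map_zero, zero_sub,
    partialD_inl_add_single, mul_single_pow, neg_smul]

theorem TH_witt (i : Fin n) (a b : ℕ) :
    TH F n (Finsupp.single (Pi.single i (a + 1), {i}) 1)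
        (Finsupp.single (Pi.single i (b + 1), {i}) 1) =
      (((a + b + 1).choose a : F) - (a + b + 1).choose (a + 1)) •
        Finsupp.single (Pi.single i (a + b + 1), {i}) 1 := by
  rw [TH_pow_mul_xi, partialD_inr_singleton, partialD_inl_single_pow, partialD_inl_single_pow,
    mul_single_pow, sub_smul]
  simp [-Finsupp.single_mul, mul_single, monMul, mchoose_single_left, inv, ← Pi.single_add,
    ← add_assoc, add_right_comm]

theorem exists_TH_polyvector {k : Fin n} {α : Fin n → ℕ} {u v : Finset (Fin n)} (hu : Odd u.card)
    (hk : k ∈ u) (huv : Disjoint (u.erase k) v) (hα : α = 0 ∨ k ∈ v) :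
    ∃ c : F, c ≠ 0 ∧
      TH F n (Finsupp.single (0, u) 1) (Finsupp.single (α + Pi.single k 1, v) 1) =
        c • Finsupp.single (α, u.erase k ∪ v) 1 := by
  refine ⟨-(-1) ^ ((u.filter fun l => l < k).card + inv (u.erase k) v), by simp, ?_⟩
  rw [TH_odd_eq_sum (single_odd hu _), Finset.sum_eq_single k _ (by simp)]
  · rw [partialD_inl_eq_zero rfl, partialD_inl_add_single]
    simp [partialD_single, monPartial, hk, -Finsupp.single_mul, mul_single, monMul, huv,
      mchoose_zero_left, pow_add]
  · intro l _ hl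
    rw [partialD_inl_eq_zero rfl, map_zero, LinearMap.zero_apply, zero_sub, neg_eq_zero]
    rcases hα with rfl | hkv
    · rw [partialD_inl_eq_zero (by simp [hl]), map_zero]
    · have hdisj : ¬ Disjoint (u.erase l) v :=
        Finset.not_disjoint_iff.2 ⟨k, Finset.mem_erase.2 ⟨hl.symm, hk⟩, hkv⟩
      simp only [partialD_single, monPartial]
      split_ifs <;> simp [-Finsupp.single_mul, mul_single, monMul, hdisj]

/-- The operator multiplying a monomial by its number of exterior variables. -/
def extDegree (F : Type*) [Field F] (n : ℕ) : Module.End F (O F n) :=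
  Finsupp.linearCombination F fun a => (a.2.card : F) • Finsupp.single a 1

theorem extDegree_single (a : Mon n) (x : F) :
    extDegree F n (Finsupp.single a x) = (a.2.card : F) • Finsupp.single a x := by
  simp [extDegree, Finsupp.linearCombination_single, mul_comm]

theorem extDegree_apply (f : O F n) (a : Mon n) : extDegree F n f a = (a.2.card : F) * f a :=
  apply_eq_of_single_eq_smul (fun b => extDegree_single b 1) f a

theorem extDegree_mul (f g : O F n) :
    extDegree F n (mul F n f g) = mul F n (extDegree F n f) g + mul F n f (extDegree F n g) := by
  induction f using Finsupp.induction_linear with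
  | zero => simp
  | add f₁ f₂ h₁ h₂ => simp only [map_add, LinearMap.add_apply, h₁, h₂]; abel
  | single a x =>
  induction g using Finsupp.induction_linear with
  | zero => simp
  | add f₁ f₂ h₁ h₂ => simp only [map_add, h₁, h₂]; abel
  | single b y =>
    simp only [extDegree_single, map_smul, LinearMap.smul_apply, mul_single, monMul]
    rw [← add_smul]
    split_ifs with h
    · rw [extDegree_single, Finset.card_union_of_disjoint h, smul_comm, Nat.cast_add]
    · simp

theorem extDegree_partialD_inl (i : Fin n) (f : O F n) :
    extDegree F n (partialD F n (Sum.inl i) f) = partialD F n (Sum.inl i) (extDegree F n f) := by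
  ext a
  simp [extDegree_apply, partialD_inl_apply]

theorem extDegree_partialD_inr (i : Fin n) (f : O F n) :
    extDegree F n (partialD F n (Sum.inr i) f) =
      partialD F n (Sum.inr i) (extDegree F n f) - partialD F n (Sum.inr i) f := by
  induction f using Finsupp.induction_linear with
  | zero => simp
  | add f g hf hg => simp only [map_add, hf, hg]; abel
  | single a x =>
    simp only [extDegree_single, map_smul, partialD_single, monPartial]
    split_ifs with h
    · rw [extDegree_single, Finset.card_erase_of_mem h, Nat.cast_pred (Finset.card_pos.2 ⟨i, h⟩),
        sub_smul, smul_sub, one_smul, smul_comm]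
    · simp

theorem extDegree_mem_supported {s : Set (Mon n)} {f : O F n} (hf : f ∈ Finsupp.supported F F s) :
    extDegree F n f ∈ Finsupp.supported F F s := by
  rw [Finsupp.mem_supported'] at hf ⊢
  intro a ha
  rw [extDegree_apply, hf a ha, mul_zero]

theorem extDegree_TH {a : O F n} (ha : a ∈ parityPart F n 1) (f : O F n) :
    extDegree F n (TH F n a f) =
      TH F n (extDegree F n a) f + TH F n a (extDegree F n f) - TH F n a f := by
  rw [TH_odd_eq_sum ha, TH_odd_eq_sum ha, TH_odd_eq_sum (extDegree_mem_supported ha), map_sum,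
    ← Finset.sum_add_distrib, ← Finset.sum_sub_distrib]
  refine Finset.sum_congr rfl fun k _ => ?_
  simp only [map_sub, extDegree_mul, extDegree_partialD_inl, extDegree_partialD_inr,
    LinearMap.sub_apply]
  abel

/-! ### The Lie algebra `𝓗𝓞` in coordinates -/

attribute [local instance 100] LieRing.ofAssociativeRing

/-- The monomials whose classes form the basis of `𝓗𝓞`. -/
def Admissible (p : ℕ) (t : Fin n → ℕ) (a : Mon n) : Prop :=
  (∀ i, a.1 i < p ^ t i) ∧ Odd a.2.card

theorem finite_admissible (p : ℕ) (t : Fin n → ℕ) : {a : Mon n | Admissible p t a}.Finite :=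
  ((Set.Finite.pi' fun i => Set.finite_lt_nat (p ^ t i)).prod Set.finite_univ).subset
    fun _ ha => ⟨ha.1, trivial⟩

variable (F) in
/-- The odd part of `𝒪(n,n;t)`. -/
def oddPart (p : ℕ) (t : Fin n → ℕ) : Submodule F (O F n) :=
  Finsupp.supported F F {a | Admissible p t a}

theorem mem_oddPart {p : ℕ} {t : Fin n → ℕ} {f : O F n} :
    f ∈ oddPart F p t ↔ f ∈ truncated F p t ∧ f ∈ parityPart F n 1 := by
  simp only [oddPart, truncated, parityPart, Finsupp.mem_supported, ← Set.subset_inter_iff,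
    Admissible, Set.ofPred_and, ZMod.natCast_eq_one_iff_odd]

theorem admissible_mono {p : ℕ} {t : Fin n → ℕ} {α β : Fin n → ℕ} {u : Finset (Fin n)}
    (hαβ : β ≤ α) (h : Admissible p t (α, u)) : Admissible p t (β, u) :=
  ⟨fun i => (hαβ i).trans_lt (h.1 i), h.2⟩

variable {p : ℕ} [Fact p.Prime] [CharP F p] {t : Fin n → ℕ}

variable (F p t) in
/-- The isomorphism `T_H` from the odd part of `𝒪(n,n;t)` to `𝓗𝓞`. -/
def oddPartEquiv : oddPart F p t ≃ₗ[F] evenHO F p t :=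
  LinearEquiv.ofBijective
    (LinearMap.codRestrict (evenHO F p t).toSubmodule (TH F n ∘ₗ (oddPart F p t).subtype)
      fun f => mem_HO_inf_evenEnd.2 ⟨f, (mem_oddPart.1 f.2).1, (mem_oddPart.1 f.2).2, rfl⟩) <| by
    constructor
    · refine (injective_iff_map_eq_zero _).2 fun f hf => Subtype.ext ?_
      exact (TH_eq_zero_iff (mem_oddPart.1 f.2).2).1 (congrArg Subtype.val hf)
    · rintro ⟨D, hD⟩
      obtain ⟨a, hat, ha, rfl⟩ := mem_HO_inf_evenEnd.1 hD
      exact ⟨⟨a, mem_oddPart.2 ⟨hat, ha⟩⟩, rfl⟩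

/-- The odd element `a` of `𝒪(n,n;t)` with `T_H(a)` equal to the given element of `𝓗𝓞`. -/
def symbol : evenHO F p t →ₗ[F] O F n :=
  (oddPart F p t).subtype ∘ₗ (oddPartEquiv F p t).symm.toLinearMap

theorem symbol_mem_oddPart (x : evenHO F p t) : symbol x ∈ oddPart F p t :=
  ((oddPartEquiv F p t).symm x).2

theorem symbol_mem_parityPart (x : evenHO F p t) : symbol x ∈ parityPart F n 1 :=
  (mem_oddPart.1 (symbol_mem_oddPart x)).2

theorem symbol_oddPartEquiv (f : oddPart F p t) : symbol (oddPartEquiv F p t f) = f :=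
  congrArg Subtype.val ((oddPartEquiv F p t).symm_apply_apply f)

theorem symbol_injective : Function.Injective (symbol : evenHO F p t → O F n) :=
  Subtype.val_injective.comp (oddPartEquiv F p t).symm.injective

theorem TH_symbol (x : evenHO F p t) : TH F n (symbol x) = x :=
  congrArg Subtype.val ((oddPartEquiv F p t).apply_symm_apply x)

theorem symbol_lie (x y : evenHO F p t) : symbol ⁅x, y⁆ = TH F n (symbol x) (symbol y) := by
  have hx : symbol x ∈ parityPart F n ((1 : ℕ) : ZMod 2) := by
    simpa using symbol_mem_parityPart x
  have hmem : TH F n (symbol x) (symbol y) ∈ oddPart F p t := mem_oddPart.2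
    ⟨TH_mem_truncated hx (mem_oddPart.1 (symbol_mem_oddPart x)).1
      (mem_oddPart.1 (symbol_mem_oddPart y)).1,
      TH_mem_evenEnd (symbol_mem_parityPart x) 1 _ (symbol_mem_parityPart y)⟩
  have hlie : ⁅x, y⁆ = oddPartEquiv F p t ⟨_, hmem⟩ := Subtype.ext <| by
    rw [LieSubalgebra.coe_bracket, LieRing.of_associative_ring_bracket, ← TH_symbol x,
      ← TH_symbol y, TH_comm (symbol_mem_parityPart x) (symbol_mem_parityPart y)]
    rfl
  rw [hlie, symbol_oddPartEquiv]

theorem symbol_apply_eq_zero (x : evenHO F p t) {a : Mon n} (h : ¬ Admissible p t a) :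
    symbol x a = 0 :=
  Finsupp.notMem_support_iff.1 fun ha => h (symbol_mem_oddPart x ha)

theorem symbol_ext {x y : evenHO F p t} (h : ∀ a, Admissible p t a → symbol x a = symbol y a) :
    x = y := by
  refine symbol_injective (Finsupp.ext fun a => ?_)
  by_cases ha : Admissible p t a
  · exact h a ha
  · rw [symbol_apply_eq_zero x ha, symbol_apply_eq_zero y ha]

open Classical in
/-- The element of `𝓗𝓞` whose coefficients at the admissible monomials are given; the values of
`g` at the other monomials are ignored. -/
def ofCoeff (g : Mon n → F) : evenHO F p t :=
  oddPartEquiv F p t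
    ⟨Finsupp.onFinset (finite_admissible p t).toFinset
      (fun a => if Admissible p t a then g a else 0) fun a ha => by simp_all,
    fun a ha => by_contra fun h => by simp_all⟩

open Classical in
theorem symbol_ofCoeff (g : Mon n → F) (a : Mon n) :
    symbol (ofCoeff g : evenHO F p t) a = if Admissible p t a then g a else 0 := by
  rw [ofCoeff, symbol_oddPartEquiv, Finsupp.onFinset_apply]

variable (F p t) in
/-- The basis element `T_H(x^(α) x^u)` of `𝓗𝓞` for an admissible monomial, and `0` for the other
monomials. -/
def mono (a : Mon n) : evenHO F p t := ofCoeff (Pi.single a 1)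

variable (F p t) in
/-- The element `T_H(x_{i'})`, which acts as `-∂_i`. -/
abbrev xi (i : Fin n) : evenHO F p t := mono F p t (0, {i})

variable (F p t) in
/-- The element `T_H(x_i x_{i'})`; these elements span a torus with the weights `weight`. -/
abbrev cartan (i : Fin n) : evenHO F p t := mono F p t (Pi.single i 1, {i})

theorem symbol_mono_apply_of_ne {a b : Mon n} (h : b ≠ a) : symbol (mono F p t a) b = 0 := by
  simp [mono, symbol_ofCoeff, h]

theorem symbol_mono {a : Mon n} (ha : Admissible p t a) :
    symbol (mono F p t a) = Finsupp.single a 1 := by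
  classical
  ext b
  rw [mono, symbol_ofCoeff, Finsupp.single_apply, Pi.single_apply]
  by_cases h : b = a
  · simp [h, ha]
  · simp [h, Ne.symm h]

theorem sum_symbol_smul_mono (x : evenHO F p t) :
    ((symbol x).sum fun a c => c • mono F p t a) = x := by
  refine symbol_injective ?_
  rw [Finsupp.sum, map_sum]
  refine (Finset.sum_congr rfl fun a ha => ?_).trans (Finsupp.sum_single (symbol x))
  rw [map_smul, symbol_mono (symbol_mem_oddPart x ha), Finsupp.smul_single_one]

theorem derivation_ext_mono {D E : LieDerivation F (evenHO F p t) (evenHO F p t)}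
    (h : ∀ a, Admissible p t a → D (mono F p t a) = E (mono F p t a)) : D = E := by
  ext1 x
  rw [← sum_symbol_smul_mono x, Finsupp.sum, map_sum, map_sum]
  refine Finset.sum_congr rfl fun a ha => ?_
  rw [map_smul, map_smul, h a (symbol_mem_oddPart x ha)]

theorem lie_mono_eq {a b c : Mon n} {r : F} (ha : Admissible p t a) (hb : Admissible p t b)
    (hc : Admissible p t c)
    (h : TH F n (Finsupp.single a 1) (Finsupp.single b 1) = r • Finsupp.single c 1) :
    ⁅mono F p t a, mono F p t b⁆ = r • mono F p t c := by
  apply symbol_injective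
  rw [symbol_lie, symbol_mono ha, symbol_mono hb, h, map_smul, symbol_mono hc]

theorem admissible_pow {i : Fin n} {m : ℕ} {u : Finset (Fin n)} (hm : m < p ^ t i)
    (hu : Odd u.card) : Admissible p t (Pi.single i m, u) := by
  refine ⟨fun j => ?_, hu⟩
  obtain rfl | hj := eq_or_ne j i
  · simpa using hm
  · simpa [hj] using pow_pos (Fact.out : p.Prime).pos (t j)

theorem admissible_zero {u : Finset (Fin n)} (hu : Odd u.card) : Admissible p t (0, u) :=
  ⟨fun i => pow_pos (Fact.out : p.Prime).pos (t i), hu⟩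

theorem admissible_cartan {i : Fin n} (ht : 0 < t i) : Admissible p t (Pi.single i 1, {i}) :=
  admissible_pow (Nat.one_lt_pow ht.ne' (Fact.out : p.Prime).one_lt) (by simp)

theorem lie_xi_apply (i : Fin n) (x : evenHO F p t) (a : Mon n) :
    symbol ⁅xi F p t i, x⁆ a = -symbol x (a.1 + Pi.single i 1, a.2) := by
  rw [symbol_lie, symbol_mono (admissible_zero (by simp)), TH_xi, Finsupp.neg_apply,
    partialD_inl_apply]

theorem lie_xi_mono (i : Fin n) {a : Mon n} (ha : Admissible p t a) :
    ⁅xi F p t i, mono F p t a⁆ =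
      if a.1 i = 0 then 0 else -mono F p t (a.1 - Pi.single i 1, a.2) := by
  apply symbol_injective
  rw [symbol_lie, symbol_mono (admissible_zero (by simp)), TH_xi, symbol_mono ha,
    partialD_single, monPartial, one_smul]
  split_ifs
  · rw [neg_zero, map_zero]
  · rw [map_neg, symbol_mono (admissible_mono tsub_le_self ha)]

theorem lie_cartan_apply {i : Fin n} (ht : 0 < t i) (x : evenHO F p t) (a : Mon n) :
    symbol ⁅cartan F p t i, x⁆ a = weight F a i * symbol x a := by
  rw [symbol_lie, symbol_mono (admissible_cartan ht), TH_cartan_apply]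

theorem lie_cartan_mono {i : Fin n} (ht : 0 < t i) (a : Mon n) :
    ⁅cartan F p t i, mono F p t a⁆ = weight F a i • mono F p t a := by
  refine symbol_ext fun b _ => ?_
  rw [lie_cartan_apply ht, map_smul, Finsupp.smul_apply, smul_eq_mul]
  obtain rfl | h := eq_or_ne b a
  · rfl
  · rw [symbol_mono_apply_of_ne h, mul_zero, mul_zero]

theorem weight_of_mem {a : Mon n} {i : Fin n} (h0 : a.1 i = 0) (hi : i ∈ a.2) :
    weight F a i = 1 := by
  simp [weight, h0, hi]

variable (F p t) in
/-- The operator on `𝓗𝓞` that multiplies `T_H(x^(α) x^u)` by `|u| - 1`. -/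
def degreeEnd : Module.End F (evenHO F p t) :=
  (oddPartEquiv F p t).conj
    ((extDegree F n - 1).restrict fun _ hf => sub_mem (extDegree_mem_supported hf) hf)

theorem symbol_degreeEnd (x : evenHO F p t) :
    symbol (degreeEnd F p t x) = extDegree F n (symbol x) - symbol x :=
  symbol_oddPartEquiv _

variable (F p t) in
/-- `degreeEnd` as a derivation: the bracket with `T_H(f)` lowers the exterior degree by one on top
of adding the exterior degree of `f`. -/
def degreeDerivation : LieDerivation F (evenHO F p t) (evenHO F p t) where
  toLinearMap := degreeEnd F p t
  leibniz' x y := by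
    apply symbol_injective
    rw [← lie_skew y, sub_neg_eq_add, map_add, symbol_degreeEnd, symbol_lie, symbol_lie, symbol_lie,
      symbol_degreeEnd, symbol_degreeEnd, extDegree_TH (symbol_mem_parityPart x)]
    simp only [map_sub, LinearMap.sub_apply]
    abel

theorem symbol_degreeDerivation (x : evenHO F p t) (a : Mon n) :
    symbol (degreeDerivation F p t x) a = ((a.2.card : F) - 1) * symbol x a := by
  rw [show degreeDerivation F p t x = degreeEnd F p t x from rfl, symbol_degreeEnd,
    Finsupp.sub_apply, extDegree_apply, sub_one_mul]

theorem lie_pow_mul_xi_of_ne {i k : Fin n} (hki : k ≠ i) {m : ℕ} {α : Fin n → ℕ}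
    (hm : m < p ^ t i) (hα : Admissible p t (α + Pi.single i 1, {k}))
    (hmα : Admissible p t (Pi.single i m + α, {k})) :
    ⁅mono F p t (Pi.single i m, {i}), mono F p t (α + Pi.single i 1, {k})⁆ =
      -((m + α i).choose m : F) • mono F p t (Pi.single i m + α, {k}) :=
  lie_mono_eq (admissible_pow hm (by simp)) hα hmα (TH_pow_mul_xi_of_ne hki m α)

theorem lie_witt (i : Fin n) {a b : ℕ} (h : a + b + 1 < p ^ t i) :
    ⁅mono F p t (Pi.single i (a + 1), {i}), mono F p t (Pi.single i (b + 1), {i})⁆ =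
      (((a + b + 1).choose a : F) - (a + b + 1).choose (a + 1)) •
        mono F p t (Pi.single i (a + b + 1), {i}) :=
  lie_mono_eq (admissible_pow (by omega) (by simp)) (admissible_pow (by omega) (by simp))
    (admissible_pow h (by simp)) (TH_witt i a b)

theorem exists_lie_polyvector {k : Fin n} {α : Fin n → ℕ} {u v : Finset (Fin n)} (hu : Odd u.card)
    (hk : k ∈ u) (huv : Disjoint (u.erase k) v) (hα : α = 0 ∨ k ∈ v)
    (hv : Admissible p t (α + Pi.single k 1, v)) :
    ∃ c : F, c ≠ 0 ∧ ⁅mono F p t (0, u), mono F p t (α + Pi.single k 1, v)⁆ =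
      c • mono F p t (α, u.erase k ∪ v) := by
  obtain ⟨c, hc, h⟩ := exists_TH_polyvector (F := F) hu hk huv hα
  refine ⟨c, hc, lie_mono_eq (admissible_zero hu) hv
    ⟨(admissible_mono le_self_add hv).1, ?_⟩ h⟩
  rw [Finset.card_union_of_disjoint huv, Finset.card_erase_of_mem hk]
  exact (Nat.Odd.sub_odd hu odd_one).add_odd hv.2

/-! ### Splitting off the inner derivations -/

theorem weight_xi (i k : Fin n) : weight F (0, {i}) k = if k = i then 1 else 0 := by
  simp [weight]

theorem weight_cartan (i k : Fin n) : weight F (Pi.single i 1, {i}) k = 0 := by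
  obtain rfl | hki := eq_or_ne k i
  · simp [weight]
  · simp [weight, hki]

theorem lie_xi_xi (i j : Fin n) : ⁅xi F p t i, xi F p t j⁆ = 0 :=
  (lie_xi_mono i (admissible_zero (by simp))).trans (if_pos rfl)

section Inner

variable (D : LieDerivation F (evenHO F p t) (evenHO F p t))

theorem symbol_derivation_xi_comm (i j : Fin n) (α : Fin n → ℕ) (u : Finset (Fin n)) :
    symbol (D (xi F p t i)) (α + Pi.single j 1, u) =
      symbol (D (xi F p t j)) (α + Pi.single i 1, u) := by
  have h := D.apply_lie_eq_sub (xi F p t i) (xi F p t j)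
  rw [lie_xi_xi, map_zero, eq_comm, sub_eq_zero] at h
  simpa only [lie_xi_apply, neg_inj] using congrArg (symbol · (α, u)) h.symm

theorem symbol_derivation_xi_cartan {k : Fin n} (ht : 0 < t k) (i : Fin n) (a : Mon n) :
    (if k = i then 1 else 0) * symbol (D (xi F p t i)) a =
      weight F a k * symbol (D (xi F p t i)) a +
        symbol (D (cartan F p t k)) (a.1 + Pi.single i 1, a.2) := by
  have h := D.apply_lie_eq_sub (cartan F p t k) (xi F p t i)
  rw [lie_cartan_mono ht, weight_xi, map_smul] at h
  simpa only [map_sub, map_smul, Finsupp.smul_apply, Finsupp.sub_apply, smul_eq_mul,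
    lie_cartan_apply ht, lie_xi_apply, sub_neg_eq_add] using congrArg (symbol · a) h

theorem symbol_derivation_xi_eq_zero (ht : ∀ i, 0 < t i) {i : Fin n} {a : Mon n}
    (ha : p ^ t i ≤ a.1 i + 1) : symbol (D (xi F p t i)) a = 0 := by
  by_contra hne
  have hadm : Admissible p t a := by_contra fun h => hne (symbol_apply_eq_zero _ h)
  have htop : a.1 i + 1 = p ^ t i := le_antisymm (hadm.1 i) ha
  have hout (x : evenHO F p t) (b : Mon n) (hb : p ^ t i ≤ b.1 i) : symbol x b = 0 :=
    symbol_apply_eq_zero x fun h => (h.1 i).not_ge hb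
  obtain ⟨k, hk⟩ := Finset.card_pos.1 hadm.2.pos
  have hcartan := symbol_derivation_xi_cartan D (ht k) i a
  rw [hout (D (cartan F p t k)) _ (by simpa using ha), add_zero] at hcartan
  have hweight := mul_right_cancel₀ hne hcartan
  obtain rfl | hki := eq_or_ne k i
  · have hcast : (a.1 k : F) + 1 = 0 := by
      rw [← Nat.cast_add_one, htop, Nat.cast_pow, CharP.cast_eq_zero, zero_pow (ht k).ne']
    simp only [weight, hk, if_true] at hweight
    exact one_ne_zero (α := F) (by linear_combination hcast - hweight)
  · obtain h0 | hk0 := eq_or_ne (a.1 k) 0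
    · rw [weight_of_mem h0 hk, if_neg hki] at hweight
      exact zero_ne_one hweight
    · refine hne ?_
      rw [← Prod.mk.eta (p := a), ← sub_single_add_single hk0, symbol_derivation_xi_comm]
      refine hout _ _ ?_
      simpa [hki.symm] using ha

theorem exists_ad_eq_on_xi (ht : ∀ i, 0 < t i) :
    ∃ b : evenHO F p t, ∀ i, D (xi F p t i) = ⁅b, xi F p t i⁆ := by
  obtain ⟨f, hf⟩ := exists_potential (fun i α u => symbol (D (xi F p t i)) (α, u))
    fun i j α => funext (symbol_derivation_xi_comm D i j α)
  refine ⟨ofCoeff fun a => f a.1 a.2, fun i => symbol_ext fun a ha => ?_⟩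
  rw [← lie_skew, map_neg, Finsupp.neg_apply, lie_xi_apply, neg_neg, symbol_ofCoeff, hf]
  split_ifs with h
  · rfl
  · refine symbol_derivation_xi_eq_zero D ht (not_lt.1 fun hi => h ⟨fun j => ?_, ha.2⟩)
    obtain rfl | hj := eq_or_ne j i
    · simpa using hi
    · simpa [hj] using ha.1 j

theorem symbol_apply_eq_zero_of_lie_xi {x : evenHO F p t} (h : ∀ i, ⁅xi F p t i, x⁆ = 0)
    {a : Mon n} (ha : a.1 ≠ 0) : symbol x a = 0 := by
  obtain ⟨i, hi⟩ := Function.ne_iff.1 ha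
  have hx := lie_xi_apply i x (a.1 - Pi.single i 1, a.2)
  rwa [h, map_zero, Finsupp.zero_apply, sub_single_add_single hi, zero_eq_neg] at hx

theorem weight_mul_symbol_derivation_cartan (ht : ∀ i, 0 < t i) (i j : Fin n) (a : Mon n) :
    weight F a i * symbol (D (cartan F p t j)) a =
      weight F a j * symbol (D (cartan F p t i)) a := by
  have h := D.apply_lie_eq_sub (cartan F p t i) (cartan F p t j)
  rw [lie_cartan_mono (ht i), weight_cartan, zero_smul, map_zero, eq_comm, sub_eq_zero] at h
  simpa only [lie_cartan_apply (ht _)] using congrArg (symbol · a) h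

variable {D} in
theorem lie_xi_derivation_cartan (ht : ∀ i, 0 < t i) (hD : ∀ i, D (xi F p t i) = 0)
    (i j : Fin n) : ⁅xi F p t j, D (cartan F p t i)⁆ = 0 := by
  have h := D.apply_lie_eq_sub (cartan F p t i) (xi F p t j)
  rwa [lie_cartan_mono (ht i), map_smul, hD, smul_zero, lie_zero, zero_sub, zero_eq_neg] at h

variable {D} in
theorem exists_ad_eq_on_cartan (ht : ∀ i, 0 < t i) (hD : ∀ i, D (xi F p t i) = 0) :
    ∃ b : evenHO F p t, (∀ i, ⁅b, xi F p t i⁆ = 0) ∧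
      ∀ i, D (cartan F p t i) = ⁅b, cartan F p t i⁆ := by
  have hconst (i : Fin n) {a : Mon n} (ha : a.1 ≠ 0) : symbol (D (cartan F p t i)) a = 0 :=
    symbol_apply_eq_zero_of_lie_xi (lie_xi_derivation_cartan ht hD i) ha
  have hcoeff (a : Mon n) : ∃ c : F, (a.1 ≠ 0 → c = 0) ∧
      ∀ i, symbol (D (cartan F p t i)) a = weight F a i * c := by
    by_cases ha : a.1 = 0 ∧ Admissible p t a
    · obtain ⟨k, hk⟩ := Finset.card_pos.1 ha.2.2.pos
      refine ⟨symbol (D (cartan F p t k)) a, fun h => absurd ha.1 h, fun i => ?_⟩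
      rw [weight_mul_symbol_derivation_cartan D ht, weight_of_mem (congrFun ha.1 k) hk, one_mul]
    · refine ⟨0, fun _ => rfl, fun i => ?_⟩
      rw [mul_zero]
      exact (not_and_or.1 ha).elim (hconst i) (symbol_apply_eq_zero _)
  choose c hc hDc using hcoeff
  refine ⟨ofCoeff fun a => -c a, fun i => ?_, fun i => ?_⟩
  · rw [← lie_skew, neg_eq_zero]
    refine symbol_ext fun a _ => ?_
    rw [lie_xi_apply, symbol_ofCoeff, hc _ (by simp), neg_zero, ite_self, neg_zero, map_zero,
      Finsupp.zero_apply]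
  · refine symbol_ext fun a ha => ?_
    rw [← lie_skew, map_neg, Finsupp.neg_apply, lie_cartan_apply (ht i), symbol_ofCoeff, if_pos ha,
      hDc, mul_neg, neg_neg]

end Inner

variable (F p t) in
/-- The derivations that annihilate the elements `x_{i'}` and `x_i x_{i'}`; they form a complement
of the inner derivations. -/
def normalized : Submodule F (LieDerivation F (evenHO F p t) (evenHO F p t)) where
  carrier := {D | ∀ i, D (xi F p t i) = 0 ∧ D (cartan F p t i) = 0}
  add_mem' hD hE i := by simp [hD i, hE i]
  zero_mem' i := by simp
  smul_mem' c D hD i := by simp [hD i]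

theorem eq_zero_of_ad_mem_normalized (ht : ∀ i, 0 < t i) {b : evenHO F p t}
    (hb : LieDerivation.ad F (evenHO F p t) b ∈ normalized F p t) : b = 0 := by
  refine symbol_ext fun a ha => ?_
  have hlie {x : evenHO F p t} (hx : LieDerivation.ad F (evenHO F p t) b x = 0) : ⁅x, b⁆ = 0 := by
    rw [← lie_skew, neg_eq_zero]
    simpa using hx
  rw [map_zero, Finsupp.zero_apply]
  by_cases h0 : a.1 = 0
  · obtain ⟨k, hk⟩ := Finset.card_pos.1 ha.2.pos
    have hb' := lie_cartan_apply (ht k) b a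
    rwa [hlie (hb k).2, map_zero, Finsupp.zero_apply, weight_of_mem (congrFun h0 k) hk, one_mul,
      eq_comm] at hb'
  · exact symbol_apply_eq_zero_of_lie_xi (fun i => hlie (hb i).1) h0

theorem isCompl_ad_normalized (ht : ∀ i, 0 < t i) :
    IsCompl (LieDerivation.ad F (evenHO F p t)).idealRange.toSubmodule (normalized F p t) := by
  constructor
  · rw [Submodule.disjoint_def]
    intro D hD hDn
    obtain ⟨b, rfl⟩ := LieDerivation.mem_ad_idealRange_iff.1 hD
    rw [eq_zero_of_ad_mem_normalized ht hDn, map_zero]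
  · rw [codisjoint_iff, eq_top_iff]
    intro D _
    obtain ⟨b, hb⟩ := exists_ad_eq_on_xi D ht
    have hxi (i : Fin n) : (D - LieDerivation.ad F (evenHO F p t) b) (xi F p t i) = 0 := by
      simp [hb]
    obtain ⟨c, hc, hDc⟩ := exists_ad_eq_on_cartan ht hxi
    refine Submodule.mem_sup.2 ⟨LieDerivation.ad F (evenHO F p t) (b + c),
      LieDerivation.mem_ad_idealRange_iff.2 ⟨_, rfl⟩, D - LieDerivation.ad F (evenHO F p t) (b + c),
      fun i => ?_, add_sub_cancel _ _⟩
    rw [map_add, ← sub_sub, LieDerivation.sub_apply, hxi, LieDerivation.sub_apply, hDc]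
    simp [hc]

/-! ### Vanishing of normalized derivations -/

section Normalized

variable {D : LieDerivation F (evenHO F p t) (evenHO F p t)}

theorem weight_eq_of_symbol_ne_zero (hD : D ∈ normalized F p t) (ht : ∀ i, 0 < t i) {a b : Mon n}
    (h : symbol (D (mono F p t b)) a ≠ 0) (i : Fin n) : weight F b i = weight F a i := by
  have hlie := D.apply_lie_eq_sub (cartan F p t i) (mono F p t b)
  rw [lie_cartan_mono (ht i), map_smul, (hD i).2, lie_zero, sub_zero] at hlie
  have hcoeff := congrArg (symbol · a) hlie
  simp only [map_smul, Finsupp.smul_apply, smul_eq_mul, lie_cartan_apply (ht i)] at hcoeff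
  exact mul_right_cancel₀ h hcoeff

theorem lie_xi_derivation_mono_eq_zero (hD : D ∈ normalized F p t) {b : Mon n}
    (hb : Admissible p t b) (hpred : ∀ i, b.1 i ≠ 0 → D (mono F p t (b.1 - Pi.single i 1, b.2)) = 0)
    (i : Fin n) : ⁅xi F p t i, D (mono F p t b)⁆ = 0 := by
  have hlie := D.apply_lie_eq_sub (xi F p t i) (mono F p t b)
  rw [(hD i).1, lie_zero, sub_zero, lie_xi_mono i hb] at hlie
  rw [← hlie]
  split_ifs with hi
  · exact map_zero D
  · rw [map_neg, hpred i hi, neg_zero]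

theorem exists_weight_of_derivation_ne_zero (hD : D ∈ normalized F p t) (ht : ∀ i, 0 < t i)
    {b : Mon n} (hb : Admissible p t b)
    (hpred : ∀ i, b.1 i ≠ 0 → D (mono F p t (b.1 - Pi.single i 1, b.2)) = 0)
    (hne : D (mono F p t b) ≠ 0) :
    ∃ v : Finset (Fin n), symbol (D (mono F p t b)) (0, v) ≠ 0 ∧ Odd v.card ∧
      ∀ i, weight F b i = if i ∈ v then 1 else 0 := by
  obtain ⟨⟨α, v⟩, hv⟩ : ∃ a, symbol (D (mono F p t b)) a ≠ 0 := by
    by_contra! h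
    exact hne (symbol_ext fun a _ => by rw [h a, map_zero, Finsupp.zero_apply])
  have hα : α = 0 := by_contra fun hα =>
    hv (symbol_apply_eq_zero_of_lie_xi (lie_xi_derivation_mono_eq_zero hD hb hpred) hα)
  subst hα
  refine ⟨v, hv, (by_contra fun h => hv (symbol_apply_eq_zero _ h) : Admissible p t _).2,
    fun i => ?_⟩
  rw [weight_eq_of_symbol_ne_zero hD ht hv]
  simp [weight]

theorem derivation_pow_mul_xi_eq_zero (hD : D ∈ normalized F p t) (ht : ∀ i, 0 < t i) {i : Fin n}
    (hpow : ∀ v, v + 1 < t i →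
      symbol (D (mono F p t (Pi.single i (p ^ (v + 1)), {i}))) (0, {i}) = 0)
    {m : ℕ} (hm : m < p ^ t i) : D (mono F p t (Pi.single i m, {i})) = 0 := by
  induction m using Nat.strong_induction_on with
  | _ m ih =>
  obtain rfl | hm0 := eq_or_ne m 0
  · simpa using (hD i).1
  by_contra hne
  have hadm : Admissible p t (Pi.single i m, {i}) := admissible_pow hm (by simp)
  have hpred (j : Fin n) (hj : (Pi.single i m : Fin n → ℕ) j ≠ 0) :
      D (mono F p t (Pi.single i m - Pi.single j 1, {i})) = 0 := by
    obtain rfl : j = i := by_contra fun h => hj (by simp [h])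
    have hsub : (Pi.single j m - Pi.single j 1 : Fin n → ℕ) = Pi.single j (m - 1) := by
      ext k; obtain rfl | hk := eq_or_ne k j <;> simp [*]
    rw [hsub]
    exact ih _ (by omega) (by omega)
  obtain ⟨w, hw, hodd, hweight⟩ := exists_weight_of_derivation_ne_zero hD ht hadm hpred hne
  have hwi : w = {i} := by
    obtain ⟨k, hk⟩ := Finset.card_pos.1 hodd.pos
    refine Finset.eq_singleton_iff_nonempty_unique_mem.2 ⟨⟨k, hk⟩, fun j hj => ?_⟩
    by_contra hji
    simpa [weight, hji, hj] using hweight j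
  subst hwi
  have hmF : (m : F) = 0 := by simpa [weight] using hweight i
  by_cases hv : ∃ v, m = p ^ v
  · obtain ⟨_ | v, rfl⟩ := hv
    · exact hne (by simpa using (hD i).2)
    · exact hw (hpow v ((Nat.pow_lt_pow_iff_right (Fact.out : p.Prime).one_lt).1 hm))
  · obtain ⟨q, hq1, hqm, hq⟩ := exists_choose_ne_choose_pred F hm0 hmF (not_exists.1 hv)
    have hsum : q - 1 + (m - q) + 1 = m := by omega
    have hlie := lie_witt (F := F) (p := p) (t := t) i (hsum.symm ▸ hm)
    rw [hsum, Nat.sub_add_cancel hq1.le] at hlie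
    exact hne (derivation_eq_zero_of_lie_eq_smul D (ih q hqm (by omega))
      (ih (m - q + 1) (by omega) (by omega)) (sub_ne_zero.2 hq.symm) hlie)

theorem derivation_vector_eq_zero (hD : D ∈ normalized F p t) (h2 : (2 : F) ≠ 0)
    (ht : ∀ i, 0 < t i)
    (hdiag : ∀ i m, m < p ^ t i → D (mono F p t (Pi.single i m, {i})) = 0)
    {α : Fin n → ℕ} {k : Fin n} (hα : Admissible p t (α, {k})) : D (mono F p t (α, {k})) = 0 := by
  induction α using WellFoundedLT.induction with
  | ind α ih =>
  by_cases hk : ∃ i, i ≠ k ∧ α i ≠ 0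
  swap
  · have hsingle : α = Pi.single k (α k) := by
      ext j
      obtain rfl | hj := eq_or_ne j k
      · simp
      · simpa [hj] using not_imp_comm.1 (fun h0 => ⟨j, hj, h0⟩) hk
    rw [hsingle]
    exact hdiag k _ (hα.1 k)
  obtain ⟨i, hik, hi⟩ := hk
  obtain hi1 | hi1 := (Nat.one_le_iff_ne_zero.2 hi).eq_or_lt
  · by_contra hne
    obtain ⟨v, -, -, hweight⟩ := exists_weight_of_derivation_ne_zero hD ht hα
      (fun j hj => ih _ (sub_single_lt hj) (admissible_mono tsub_le_self hα)) hne
    have hweight := hweight i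
    simp only [weight, Finset.mem_singleton, hik, if_false, ← hi1, Nat.cast_one, zero_sub]
      at hweight
    split_ifs at hweight
    · exact h2 (by linear_combination -hweight)
    · exact neg_ne_zero.2 one_ne_zero hweight
  · -- `x^(α) ξ_k` is a bracket of `x_i^(α_i) ξ_i` and a smaller `x^(β) ξ_k`, as `α_i ≥ 2`.
    have hlt : Function.update α i 1 < α := update_lt_self_iff.2 hi1
    have hγ : Function.update α i 0 + Pi.single i 1 = Function.update α i 1 := by
      ext j; obtain rfl | hj := eq_or_ne j i <;> simp [*]
    have hα' : Pi.single i (α i) + Function.update α i 0 = α := by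
      ext j; obtain rfl | hj := eq_or_ne j i <;> simp [*]
    have hγadm := admissible_mono hlt.le hα
    have hlie := lie_pow_mul_xi_of_ne (F := F) hik.symm (hα.1 i) (hγ.symm ▸ hγadm)
      (hα'.symm ▸ hα)
    rw [hα', hγ] at hlie
    exact derivation_eq_zero_of_lie_eq_smul D (hdiag i _ (hα.1 i)) (ih _ hlt hγadm)
      (by simp) hlie

theorem derivation_trivector_eq_zero (hD : D ∈ normalized F p t) (ht : ∀ i, 0 < t i)
    (hvec : ∀ α k, Admissible p t (α, {k}) → D (mono F p t (α, {k})) = 0)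
    {s s₀ : Finset (Fin n)} (hs₀ : Odd s₀.card) (h0 : symbol (D (mono F p t (0, s₀))) (0, s₀) = 0)
    (hs : s.card = s₀.card) : D (mono F p t (0, s)) = 0 := by
  refine (exchange_induction (P := fun s => s.card = s₀.card ∧ D (mono F p t (0, s)) = 0)
    ⟨rfl, ?_⟩ (fun s j hj i hi hP => ?_) hs).2
  · by_contra hne
    obtain ⟨v, hv, -, hweight⟩ := exists_weight_of_derivation_ne_zero hD ht (admissible_zero hs₀)
      (fun i hi => absurd rfl hi) hne
    obtain rfl : v = s₀ := by
      ext i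
      have hi := hweight i
      simp only [weight, Pi.zero_apply, Nat.cast_zero, sub_zero] at hi
      split_ifs at hi <;> simp_all
    exact hv h0
  · have hcard : (s.erase j).card + 1 = s₀.card := (Finset.card_erase_add_one hj).trans hP.1
    have hadm : Admissible p t (Pi.single j 1, {i}) := admissible_pow
      (Nat.one_lt_pow (ht j).ne' (Fact.out : p.Prime).one_lt) (by simp)
    obtain ⟨c, hc, hlie⟩ := exists_lie_polyvector (F := F) (α := 0) (u := s) (v := {i})
      (hP.1 ▸ hs₀) hj (by simp [hi]) (Or.inl rfl) (by rwa [zero_add])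
    rw [zero_add, Finset.union_singleton] at hlie
    have hi' : i ∉ s.erase j := fun h => hi (Finset.mem_of_mem_erase h)
    exact ⟨by rw [Finset.card_insert_of_notMem hi', hcard],
      derivation_eq_zero_of_lie_eq_smul D hP.2 (hvec _ _ hadm) hc hlie⟩

theorem derivation_polyvector_eq_zero (hD : D ∈ normalized F p t) (h2 : (2 : F) ≠ 0)
    (ht : ∀ i, 0 < t i) (hvec : ∀ α k, Admissible p t (α, {k}) → D (mono F p t (α, {k})) = 0)
    (htri : ∀ s : Finset (Fin n), s.card = 3 → D (mono F p t (0, s)) = 0) (m : ℕ)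
    {α : Fin n → ℕ} {u : Finset (Fin n)} (hα : Admissible p t (α, u)) (hu : u.card = 2 * m + 1) :
    D (mono F p t (α, u)) = 0 := by
  induction m generalizing α u with
  | zero =>
    obtain ⟨k, rfl⟩ := Finset.card_eq_one.1 hu
    exact hvec α k hα
  | succ m ihm =>
  induction α using WellFoundedLT.induction with
  | ind α ih =>
  obtain ⟨w, hwu, hw⟩ := Finset.exists_subset_card_eq (show 3 ≤ u.card by omega)
  obtain ⟨k, hk⟩ := Finset.card_pos.1 (show 0 < w.card by omega)
  by_contra hne
  -- If `α_k` were maximal, the weight at `k` would be `1 - (-1) = 2`, which is neither `0` nor `1`.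
  have hαk : α k + 1 < p ^ t k := by
    refine (Nat.succ_le_of_lt (hα.1 k)).lt_of_ne fun htop => ?_
    obtain ⟨v, -, -, hweight⟩ := exists_weight_of_derivation_ne_zero hD ht hα
      (fun j hj => ih _ (sub_single_lt hj) (admissible_mono tsub_le_self hα)) hne
    have hcast : (α k : F) + 1 = 0 := by
      rw [← Nat.cast_succ, htop, Nat.cast_pow, CharP.cast_eq_zero, zero_pow (ht k).ne']
    have hweight := hweight k
    simp only [weight, if_pos (hwu hk)] at hweight
    split_ifs at hweight
    · exact one_ne_zero (α := F) (by linear_combination hcast + hweight)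
    · exact h2 (by linear_combination hcast + hweight)
  have hcard : (insert k (u \ w)).card = 2 * m + 1 := by
    rw [Finset.card_insert_of_notMem (by simp [hk]), Finset.card_sdiff_of_subset hwu]
    omega
  have hadm : Admissible p t (α + Pi.single k 1, insert k (u \ w)) := by
    refine ⟨fun j => ?_, hcard ▸ odd_two_mul_add_one m⟩
    obtain rfl | hj := eq_or_ne j k
    · simpa using hαk
    · simpa [hj] using hα.1 j
  obtain ⟨c, hc, hlie⟩ := exists_lie_polyvector (F := F) (u := w) (hw ▸ by decide) hk
    (by grind [Finset.disjoint_left]) (Or.inr (Finset.mem_insert_self _ _)) hadm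
  rw [show w.erase k ∪ insert k (u \ w) = u by grind] at hlie
  exact hne (derivation_eq_zero_of_lie_eq_smul D (htri w hw) (ihm hadm hcard) hc hlie)

theorem eq_zero_of_mem_normalized (hD : D ∈ normalized F p t) (h2 : (2 : F) ≠ 0)
    (ht : ∀ i, 0 < t i)
    (hpow : ∀ i v, v + 1 < t i →
      symbol (D (mono F p t (Pi.single i (p ^ (v + 1)), {i}))) (0, {i}) = 0)
    {s₀ : Finset (Fin n)} (hs₀ : s₀.card = 3)
    (h0 : symbol (D (mono F p t (0, s₀))) (0, s₀) = 0) : D = 0 := by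
  have hvec (α : Fin n → ℕ) (k : Fin n) (hα : Admissible p t (α, {k})) :
      D (mono F p t (α, {k})) = 0 :=
    derivation_vector_eq_zero hD h2 ht
      (fun i _ hm => derivation_pow_mul_xi_eq_zero hD ht (hpow i) hm) hα
  refine derivation_ext_mono fun a ha => ?_
  obtain ⟨m, hm⟩ := ha.2
  exact derivation_polyvector_eq_zero hD h2 ht hvec (fun s hs =>
    derivation_trivector_eq_zero hD ht hvec (hs₀ ▸ by decide) h0 (hs.trans hs₀.symm)) m ha hm

end Normalized

/-! ### The outer derivations -/

section Outer

variable (F p t) in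
/-- The derivation `∂_i^(p^v)` of `𝓗𝓞`: `∂_i` acts as the bracket with `-T_H(x_{i'})`. -/
def partialPower (i : Fin n) (v : ℕ) : LieDerivation F (evenHO F p t) (evenHO F p t) :=
  powDerivation p (LieDerivation.ad F (evenHO F p t) (-xi F p t i)) v

theorem symbol_partialPower (i : Fin n) (v : ℕ) (x : evenHO F p t) (a : Mon n) :
    symbol (partialPower F p t i v x) a = symbol x (a.1 + Pi.single i (p ^ v), a.2) := by
  rw [partialPower, powDerivation_apply]
  generalize p ^ v = q
  induction q generalizing a with
  | zero => simp
  | succ q ih =>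
    rw [Function.iterate_succ_apply', LieDerivation.ad_apply_apply, neg_lie, map_neg,
      Finsupp.neg_apply, lie_xi_apply, neg_neg, ih, add_assoc, ← Pi.single_add, add_comm 1]

/-- The indices of the outer derivations: `none` for the degree derivation, `some ⟨i, v⟩` for
`∂_i^(p^(v+1))`, where `1 ≤ v + 1 < t i`. -/
abbrev OuterIndex (t : Fin n → ℕ) : Type := Option (Σ i : Fin n, Fin (t i - 1))

variable (F p t) in
/-- The derivations whose classes form a basis of the outer derivation algebra. -/
def outerDerivation : OuterIndex t → LieDerivation F (evenHO F p t) (evenHO F p t)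
  | none => degreeDerivation F p t
  | some j => partialPower F p t j.1 (j.2 + 1)

theorem outerDerivation_comm (j k : OuterIndex t) :
    ⁅outerDerivation F p t j, outerDerivation F p t k⁆ = 0 := by
  ext1 x
  rw [LieDerivation.commutator_apply, LieDerivation.zero_apply, sub_eq_zero]
  refine symbol_ext fun a _ => ?_
  cases j <;> cases k <;> simp only [outerDerivation, symbol_partialPower, symbol_degreeDerivation]
  rw [add_right_comm]

theorem outerDerivation_mem_normalized (j : OuterIndex t) :
    outerDerivation F p t j ∈ normalized F p t := by
  suffices h : ∀ (i : Fin n) (m : ℕ), m ≤ 1 →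
      outerDerivation F p t j (mono F p t (Pi.single i m, {i})) = 0 from
    fun i => ⟨by simpa using h i 0 zero_le_one, h i 1 le_rfl⟩
  refine fun i m hm => symbol_ext fun a _ => ?_
  rw [map_zero, Finsupp.zero_apply]
  cases j with
  | none =>
    rw [outerDerivation, symbol_degreeDerivation]
    obtain rfl | ha := eq_or_ne a (Pi.single i m, {i})
    · simp
    · rw [symbol_mono_apply_of_ne ha, mul_zero]
  | some j =>
    rw [outerDerivation, symbol_partialPower]
    refine symbol_mono_apply_of_ne fun h => ?_
    have hlt : 1 < p ^ ((j.2 : ℕ) + 1) := Nat.one_lt_pow (by omega) (Fact.out : p.Prime).one_lt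
    have hle : (Pi.single i m : Fin n → ℕ) j.1 ≤ 1 := by
      obtain rfl | hj := eq_or_ne j.1 i <;> simp [*]
    have heq := congrFun (congrArg Prod.fst h) j.1
    simp only [Pi.add_apply, Pi.single_eq_same] at heq
    omega

variable (F p t) in
/-- The coefficient of `T_H(a)` in the value of a derivation at `T_H(b)`, for monomials `a`, `b`. -/
def matrixCoeff (a b : Mon n) : Module.Dual F (LieDerivation F (evenHO F p t) (evenHO F p t)) where
  toFun D := symbol (D (mono F p t b)) a
  map_add' D E := by simp
  map_smul' c D := by simp

variable (F p t) in
/-- The coordinates dual to `outerDerivation`, where `s₀` is any set of three indices. The degree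
derivation multiplies `T_H(x^{s₀})` by `2`, which explains the factor. -/
def outerCoordinate (s₀ : Finset (Fin n)) :
    OuterIndex t → Module.Dual F (LieDerivation F (evenHO F p t) (evenHO F p t))
  | none => (2 : F)⁻¹ • matrixCoeff F p t (0, s₀) (0, s₀)
  | some j => matrixCoeff F p t (0, {j.1}) (Pi.single j.1 (p ^ ((j.2 : ℕ) + 1)), {j.1})

variable {s₀ : Finset (Fin n)}

theorem outerCoordinate_outerDerivation_self (h2 : (2 : F) ≠ 0) (hs₀ : s₀.card = 3)
    (j : OuterIndex t) : outerCoordinate F p t s₀ j (outerDerivation F p t j) = 1 := by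
  cases j with
  | none =>
    change (2 : F)⁻¹ * symbol (degreeDerivation F p t _) _ = 1
    rw [symbol_degreeDerivation, symbol_mono (admissible_zero (hs₀ ▸ by decide)),
      Finsupp.single_eq_same, hs₀, mul_one, Nat.cast_ofNat, show (3 : F) - 1 = 2 by norm_num,
      inv_mul_cancel₀ h2]
  | some j =>
    change symbol (partialPower F p t _ _ _) _ = 1
    have hlt : (j.2 : ℕ) + 1 < t j.1 := by omega
    rw [symbol_partialPower, symbol_mono (admissible_pow
      (Nat.pow_lt_pow_right (Fact.out : p.Prime).one_lt hlt) (by simp)), zero_add,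
      Finsupp.single_eq_same]

theorem outerCoordinate_outerDerivation_of_ne {j k : OuterIndex t} (hjk : j ≠ k) :
    outerCoordinate F p t s₀ j (outerDerivation F p t k) = 0 := by
  have hpos (v : ℕ) : p ^ v ≠ 0 := pow_ne_zero v (Fact.out : p.Prime).ne_zero
  cases j with
  | none =>
    obtain _ | k := k
    · exact absurd rfl hjk
    change (2 : F)⁻¹ * symbol (partialPower F p t _ _ _) _ = 0
    rw [symbol_partialPower,
      symbol_mono_apply_of_ne (by simp [(Fact.out : p.Prime).ne_zero]), mul_zero]
  | some j =>
    cases k with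
    | none =>
      change symbol (degreeDerivation F p t _) _ = 0
      simp [symbol_degreeDerivation]
    | some k =>
      change symbol (partialPower F p t _ _ _) _ = 0
      rw [symbol_partialPower]
      refine symbol_mono_apply_of_ne fun h => hjk ?_
      obtain ⟨i, v⟩ := j
      obtain ⟨l, w⟩ := k
      have heq := congrFun (congrArg Prod.fst h) l
      simp only [zero_add, Pi.single_eq_same] at heq
      obtain rfl : l = i := by_contra fun hne => hpos _ (heq.trans (Pi.single_eq_of_ne hne _))
      rw [Pi.single_eq_same] at heq
      have hvw := Nat.pow_right_injective (Fact.out : p.Prime).two_le heq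
      rw [Fin.ext (Nat.succ_injective hvw)]

theorem linearIndependent_outerDerivation (h2 : (2 : F) ≠ 0) (hn : 3 ≤ n) :
    LinearIndependent F (outerDerivation F p t) := by
  obtain ⟨s₀, -, hs₀⟩ := Finset.exists_subset_card_eq (s := (Finset.univ : Finset (Fin n)))
    (n := 3) (by simpa using hn)
  exact LinearIndependent.of_pairwise_dual_eq_zero_one _ (outerCoordinate F p t s₀)
    (fun _ _ hjk => outerCoordinate_outerDerivation_of_ne hjk)
    (outerCoordinate_outerDerivation_self h2 hs₀)

theorem eq_zero_of_outerCoordinate_eq_zero (h2 : (2 : F) ≠ 0) (ht : ∀ i, 0 < t i)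
    (hs₀ : s₀.card = 3) {D : LieDerivation F (evenHO F p t) (evenHO F p t)}
    (hD : D ∈ normalized F p t) (h : ∀ j, outerCoordinate F p t s₀ j D = 0) : D = 0 :=
  eq_zero_of_mem_normalized hD h2 ht (fun i v hv => h (some ⟨i, v, by omega⟩)) hs₀
    ((mul_eq_zero.1 (h none)).resolve_left (inv_ne_zero h2))

theorem span_outerDerivation (h2 : (2 : F) ≠ 0) (hn : 3 ≤ n) (ht : ∀ i, 0 < t i) :
    Submodule.span F (Set.range (outerDerivation F p t)) = normalized F p t := by
  refine le_antisymm
    (Submodule.span_le.2 (Set.range_subset_iff.2 outerDerivation_mem_normalized)) fun D hD => ?_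
  obtain ⟨s₀, -, hs₀⟩ := Finset.exists_subset_card_eq (s := (Finset.univ : Finset (Fin n)))
    (n := 3) (by simpa using hn)
  set E := ∑ j, outerCoordinate F p t s₀ j D • outerDerivation F p t j with hE
  have hEmem : E ∈ normalized F p t :=
    sum_mem fun j _ => Submodule.smul_mem _ _ (outerDerivation_mem_normalized j)
  have hcoord (k : OuterIndex t) : outerCoordinate F p t s₀ k (D - E) = 0 := by
    rw [map_sub, sub_eq_zero, hE, map_sum, Finset.sum_eq_single k, map_smul,
      outerCoordinate_outerDerivation_self h2 hs₀, smul_eq_mul, mul_one]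
    · intro j _ hjk
      rw [map_smul, outerCoordinate_outerDerivation_of_ne hjk.symm, smul_zero]
    · exact fun hk => absurd (Finset.mem_univ k) hk
  rw [sub_eq_zero.1 (eq_zero_of_outerCoordinate_eq_zero h2 ht hs₀ (sub_mem hD hEmem) hcoord)]
  exact sum_mem fun j _ => Submodule.smul_mem _ _ (Submodule.subset_span ⟨j, rfl⟩)

theorem lie_eq_zero_of_mem_span_outerDerivation
    {D E : LieDerivation F (evenHO F p t) (evenHO F p t)}
    (hD : D ∈ Submodule.span F (Set.range (outerDerivation F p t)))
    (hE : E ∈ Submodule.span F (Set.range (outerDerivation F p t))) : ⁅D, E⁆ = 0 := by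
  induction hD, hE using Submodule.span_induction₂ with
  | mem_mem D E hD hE =>
    obtain ⟨j, rfl⟩ := hD
    obtain ⟨k, rfl⟩ := hE
    exact outerDerivation_comm j k
  | zero_left => exact zero_lie _
  | zero_right => exact lie_zero _
  | add_left _ _ _ _ _ _ h h' => rw [add_lie, h, h', add_zero]
  | add_right _ _ _ _ _ _ h h' => rw [lie_add, h, h', add_zero]
  | smul_left _ _ _ _ _ h => rw [smul_lie, h, smul_zero]
  | smul_right _ _ _ _ _ h => rw [lie_smul, h, smul_zero]

variable (F p t) in
/-- The classes of the outer derivations form a basis of the outer derivation algebra. -/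
def outerBasis (h2 : (2 : F) ≠ 0) (hn : 3 ≤ n) (ht : ∀ i, 0 < t i) :
    Module.Basis (OuterIndex t) F (OuterDer F (evenHO F p t)) :=
  (Module.Basis.span (linearIndependent_outerDerivation h2 hn)).map
    ((LinearEquiv.ofEq _ _ (span_outerDerivation h2 hn ht)).trans
      (Submodule.quotientEquivOfIsCompl _ _ (isCompl_ad_normalized ht)).symm)

end Outer

end

end OddHamiltonian

theorem mainTheorem5_general {F : Type*} [Field F] (p : ℕ) [Fact p.Prime] [CharP F p] (hp : 2 < p)
    (n : ℕ) (hn : 3 ≤ n) (t : Fin n → ℕ) (ht : ∀ i, 1 ≤ t i) :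
    IsLieAbelian (OddHamiltonian.OuterDer F (OddHamiltonian.evenHO F p t)) ∧
      Module.Finite F (OddHamiltonian.OuterDer F (OddHamiltonian.evenHO F p t)) ∧
      (Module.finrank F (OddHamiltonian.OuterDer F (OddHamiltonian.evenHO F p t)) : ℤ) =
        ∑ i, (t i : ℤ) - n + 1 := by
  have h2 : (2 : F) ≠ 0 := fun h =>
    hp.not_ge (Nat.le_of_dvd two_pos ((CharP.cast_eq_zero_iff F p 2).1 (mod_cast h)))
  let b := OddHamiltonian.outerBasis F p t h2 hn ht
  refine ⟨?_, Module.Finite.of_basis b, ?_⟩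
  · refine OddHamiltonian.isLieAbelian_quotient_of_codisjoint _ _
      (OddHamiltonian.isCompl_ad_normalized ht).codisjoint fun D hD E hE => ?_
    rw [← OddHamiltonian.span_outerDerivation h2 hn ht] at hD hE
    exact OddHamiltonian.lie_eq_zero_of_mem_span_outerDerivation hD hE
  · rw [Module.finrank_eq_card_basis b, Fintype.card_option, Fintype.card_sigma]
    simp only [Fintype.card_fin]
    push_cast
    rw [Finset.sum_congr rfl fun i _ => Nat.cast_pred (R := ℤ) (ht i)]
    simp

theorem mainTheorem5 {F : Type*} [Field F] (p : ℕ) [Fact p.Prime] [CharP F p] (hp : 3 < p)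
    (n : ℕ) (hn : 3 ≤ n) (t : Fin n → ℕ) (ht : ∀ i, 1 ≤ t i) :
    IsLieAbelian (OddHamiltonian.OuterDer F (OddHamiltonian.evenHO F p t)) ∧
      Module.Finite F (OddHamiltonian.OuterDer F (OddHamiltonian.evenHO F p t)) ∧
      (Module.finrank F (OddHamiltonian.OuterDer F (OddHamiltonian.evenHO F p t)) : ℤ) =
        ∑ i, (t i : ℤ) - n + 1 :=
  mainTheorem5_general p (by omega) n hn t ht
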